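/- Let $F$ be a field of characteristic $0$, $E$ a Lie algebra over $F$ (of arbitrary dimension) and $H\subset E$ a subalgebra. For $\alpha\in H^*$ put $E_\alpha=\{e\in E: [h,e]=\alpha(h)e \text{ for all } h\in H\}$, and let $R=\{\alpha\in H^*: E_\alpha\neq 0\}$ be the set of roots. The pair $(E,H)$ is an extended affine Lie algebra (EALA) if there is a bilinear form $(\cdot|\cdot)$ on $E$ such that the following axioms hold. (EA1) $(\cdot|\cdot)$ is symmetric, nondegenerate and invariant, i.e. $([x,y]|z)=(x|[y,z])$. (EA2) $H\neq 0$ is finite-dimensional, $E=\bigoplus_{\alpha\in H^*}E_\alpha$, and $E_0=H$. By (EA1) and (EA2) the form is nondegenerate on $H$; for $\alpha\in H^*$ let $t_\alpha\in H$ be given by $(t_\alpha|h)=\alpha(h)$ for all $h\in H$, and put $(\alpha|\beta)=(t_\alpha|t_\beta)$. Let $R^0=\{\alpha\in R:(\alpha|\alpha)=0\}$, $R^{\rm an}=R\setminus R^0$, and let the core $E_c$ be the subalgebra of $E$ generated by all $E_\alpha$, $\alpha\in R^{\rm an}$. (EA3) For $\alpha\in R^{\rm an}$ and $x\in E_\alpha$,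 $\operatorname{ad}x$ is locally nilpotent on $E$. (EA4) If $R^{\rm an}=R_1\cup R_2$ with $(R_1|R_2)=0$, then $R_1=\emptyset$ or $R_2=\emptyset$. (EA5) $\{e\in E:[e,E_c]=0\}\subset E_c$. (EA6) $\Lambda=\operatorname{Span}_{\mathbb Z}(R^0)\subset H^*$ is a free abelian group of finite rank. The rank of $\Lambda$ is the nullity of the EALA. Then the following are equivalent: (i) $(E,H)$ is an EALA of nullity $0$; (ii) $(E,H)$ is an EALA and $E$ is finite-dimensional; (iii) $E$ is a finite-dimensional split simple Lie algebra with splitting Cartan subalgebra $H$, i.e. $E$ is finite-dimensional and simple, and $H$ is a Cartan subalgebra such that $\operatorname{ad}h$ is triangularizable over $F$ for every $h\in H$. In this case, for every form satisfying (EA1)--(EA6), the nullity is $0$ and $E$ equals its core; moreover, with $X=\operatorname{Span}_F(R)$, $X^0=\{x\in X:(x|X)=0\}$ and $f:X\to X/X^0$ the canonical map, the set of roots $R$ coincides with its quotient root system $S=f(R)$ (that is, $f$ is bijective), and $R$ (equivalently $S$) is an irreducible reduced finite root system in $X$, where root systems are understood to contain $0$. -/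

import Mathlib

open Module

namespace EALA

variable {F E : Type*} [Field F] [LieRing E] [LieAlgebra F E]

/-- The simultaneous eigenspace `E_α = {e ∈ E : [h, e] = α(h) e for all h ∈ H}`. -/
def rootSpace (H : LieSubalgebra F E) (α : Dual F H) : Submodule F E where
  carrier := {e | ∀ h : H, ⁅(h : E), e⁆ = α h • e}
  zero_mem' := by intro h; simp
  add_mem' := by
    intro a b ha hb h
    rw [lie_add, ha h, hb h, smul_add]
  smul_mem' := by
    intro c a ha h
    rw [lie_smul, ha h, smul_comm]

theorem mem_rootSpace {H : LieSubalgebra F E} {α : Dual F H} {e : E} :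
    e ∈ rootSpace H α ↔ ∀ h : H, ⁅(h : E), e⁆ = α h • e := Iff.rfl

/-- The set of roots `R = {α ∈ H* : E_α ≠ 0}`; it contains `0` as soon as `E_0 ≠ 0`. -/
def roots (H : LieSubalgebra F E) : Set (Dual F H) := {α | rootSpace H α ≠ ⊥}

/-- (EA1) and (EA2): `B` is an invariant nondegenerate symmetric bilinear form on `E`, and `H` is a
nontrivial finite-dimensional toral and self-centralizing subalgebra of `E`. -/
structure IsToralPair (H : LieSubalgebra F E) (B : LinearMap.BilinForm F E) : Prop where
  symm : ∀ x y : E, B x y = B y x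
  invariant : ∀ x y z : E, B ⁅x, y⁆ z = B x ⁅y, z⁆
  nondegenerate : ∀ x : E, (∀ y : E, B x y = 0) → x = 0
  nontrivial : H ≠ ⊥
  finiteDimensional : FiniteDimensional F H
  /-- `E` is the direct sum of the `E_α`, `α ∈ H*`: their sum is direct ... -/
  independent : iSupIndep (rootSpace H)
  /-- ... and equals `E`. -/
  iSup_eq_top : ⨆ α : Dual F H, rootSpace H α = ⊤
  selfCentralizing : rootSpace H 0 = H.toSubmodule

namespace IsToralPair

variable {H : LieSubalgebra F E} {B : LinearMap.BilinForm F E}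

/-- The restriction of the form to `H` is nondegenerate. -/
theorem nondegenerate_restrict (h : IsToralPair H B) :
    (B.restrict H.toSubmodule).Nondegenerate := by
  have key : ∀ x : H, (∀ y : H, B x y = 0) → x = 0 := by
    intro x hx
    apply Subtype.ext
    apply h.nondegenerate
    intro y
    have hy : y ∈ ⨆ α : Dual F H, rootSpace H α := by rw [h.iSup_eq_top]; trivial
    induction hy using Submodule.iSup_induction' with
    | zero => simp
    | add a b _ _ ha hb => rw [map_add, ha, hb, add_zero]
    | mem α e he =>
      by_cases hα : α = 0
      · subst hα
        rw [h.selfCentralizing] at he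
        exact hx ⟨e, he⟩
      · obtain ⟨k, hk⟩ : ∃ k : H, α k ≠ 0 := by
          by_contra hc
          push Not at hc
          exact hα (LinearMap.ext hc)
        have hxk : ⁅(x : E), (k : E)⁆ = 0 := by
          have hx0 : (x : E) ∈ rootSpace H 0 := by rw [h.selfCentralizing]; exact x.2
          rw [← lie_skew, mem_rootSpace.1 hx0 k]
          simp
        have h1 := h.invariant x k e
        rw [hxk, mem_rootSpace.1 he k, map_smul, map_zero, LinearMap.zero_apply, smul_eq_mul] at h1
        exact (mul_eq_zero.1 h1.symm).resolve_left hk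
  refine ⟨fun x hx => key x hx, fun y hy => key y fun x => ?_⟩
  rw [h.symm]
  exact hy x

/-- The map `α ↦ t_α` from `H*` to `H`, where `t_α ∈ H` is the unique element such that
`(t_α | k) = α(k)` for all `k ∈ H`. -/
noncomputable def t (h : IsToralPair H B) : Dual F H ≃ₗ[F] H :=
  haveI : FiniteDimensional F H.toSubmodule := h.finiteDimensional
  ((B.restrict H.toSubmodule).toDual h.nondegenerate_restrict).symm

theorem t_spec (h : IsToralPair H B) (α : Dual F H) (k : H) : B (h.t α : E) (k : E) = α k := by
  have : FiniteDimensional F H.toSubmodule := h.finiteDimensional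
  exact LinearMap.BilinForm.apply_toDual_symm_apply (hB := h.nondegenerate_restrict) α k

/-- The transported symmetric bilinear form on `H*`: `(α | β) = (t_α | t_β)`. -/
noncomputable def dualForm (h : IsToralPair H B) : LinearMap.BilinForm F (Dual F H) :=
  (B.restrict H.toSubmodule).compl₁₂ h.t.toLinearMap h.t.toLinearMap

theorem dualForm_apply (h : IsToralPair H B) (α β : Dual F H) :
    h.dualForm α β = B (h.t α : E) (h.t β : E) := rfl

/-- The null roots `R⁰`. -/
def nullRoots (h : IsToralPair H B) : Set (Dual F H) := {α ∈ roots H | h.dualForm α α = 0}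

/-- The anisotropic roots. -/
def anisotropicRoots (h : IsToralPair H B) : Set (Dual F H) := {α ∈ roots H | h.dualForm α α ≠ 0}

/-- The core: the subalgebra of `E` generated by all anisotropic root spaces. -/
def core (h : IsToralPair H B) : LieSubalgebra F E :=
  LieSubalgebra.lieSpan F E (⋃ α ∈ h.anisotropicRoots, (rootSpace H α : Set E))

/-- The subgroup `Λ = Span_ℤ(R⁰)` of `(H*, +)`. -/
def nullLattice (h : IsToralPair H B) : AddSubgroup (Dual F H) := AddSubgroup.closure h.nullRoots

/-- The rank of `Λ`. -/
noncomputable def nullity (h : IsToralPair H B) : ℕ := finrank ℤ h.nullLattice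

end IsToralPair

/-- `(E, H)` satisfies the axioms (EA1) -- (EA6) with respect to the form `B`. -/
structure IsEALAForm (H : LieSubalgebra F E) (B : LinearMap.BilinForm F E) : Prop
    extends toral : IsToralPair H B where
  /-- (EA3): `ad x` is locally nilpotent for every anisotropic root vector `x`. -/
  locallyNilpotent : ∀ α ∈ toral.anisotropicRoots, ∀ x ∈ rootSpace H α,
    ∀ e : E, ∃ n : ℕ, ((LieAlgebra.ad F E x) ^ n) e = 0
  /-- (EA4): the set of anisotropic roots is connected. -/
  connected : ∀ R₁ R₂ : Set (Dual F H), toral.anisotropicRoots = R₁ ∪ R₂ →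
    (∀ α ∈ R₁, ∀ β ∈ R₂, toral.dualForm α β = 0) → R₁ = ∅ ∨ R₂ = ∅
  /-- (EA5): tameness. -/
  tame : ∀ e : E, (∀ x ∈ toral.core, ⁅e, x⁆ = 0) → e ∈ toral.core
  /-- (EA6): `Λ` is free of finite rank. -/
  free : Module.Free ℤ toral.nullLattice
  finite : Module.Finite ℤ toral.nullLattice

/-- `(E, H)` is an extended affine Lie algebra. -/
def IsEALA (H : LieSubalgebra F E) : Prop := ∃ B : LinearMap.BilinForm F E, IsEALAForm H B

/-- `(E, H)` is an extended affine Lie algebra of nullity `n`. -/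
def IsEALAOfNullity (H : LieSubalgebra F E) (n : ℕ) : Prop :=
  ∃ (B : LinearMap.BilinForm F E) (h : IsEALAForm H B), h.toral.nullity = n

/-- `E` is a finite-dimensional split simple Lie algebra with splitting Cartan subalgebra `H`, i.e.
a Cartan subalgebra such that `ad x` is triangularizable over `F` for every `x ∈ H`. -/
structure IsSplitSimple (H : LieSubalgebra F E) : Prop where
  finiteDimensional : FiniteDimensional F E
  simple : LieAlgebra.IsSimple F E
  cartan : H.IsCartanSubalgebra
  split : LieModule.IsTriangularizable F H E

section RootSystems

variable {Y : Type*} [AddCommGroup Y] [Module F Y]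

/-- `S ⊆ Y` is an irreducible reduced finite root system, with the convention `0 ∈ S`: the set
`S \ {0}` is the set of roots of a finite crystallographic root system in `Y` that is reduced and
irreducible. -/
def IsIrreducibleReducedRootSystem (S : Set Y) : Prop :=
  (0 : Y) ∈ S ∧ S.Finite ∧
    ∃ P : RootPairing (S \ {0} : Set Y) F Y (Dual F Y),
      (∀ a, P.root a = (a : Y)) ∧ P.IsRootSystem ∧ P.IsCrystallographic ∧
        P.IsReduced ∧ P.IsIrreducible

/-- For a subset `R` of a vector space with span `X = Span_F(R)`: the set `R` as a subset of `X`. -/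
def inSpan (R : Set Y) : Set (Submodule.span F R) := {x | (x : Y) ∈ R}

/-- The radical `X⁰ = {x ∈ X : (x | X) = 0}` of the restriction of the form `b` to
`X = Span_F(R)`. -/
def spanRadical (b : LinearMap.BilinForm F Y) (R : Set Y) : Submodule F (Submodule.span F R) :=
  LinearMap.ker (b.restrict (Submodule.span F R))

/-- The canonical map `f : X → X / X⁰`, where `X = Span_F(R)`. -/
def toQuotient (b : LinearMap.BilinForm F Y) (R : Set Y) :
    Submodule.span F R →ₗ[F] (Submodule.span F R ⧸ spanRadical b R) :=
  (spanRadical b R).mkQ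

/-- The quotient root system `S = f(R) ⊆ X / X⁰` of `R`. -/
def quotientRoots (b : LinearMap.BilinForm F Y) (R : Set Y) :
    Set (Submodule.span F R ⧸ spanRadical b R) :=
  toQuotient b R '' inSpan R

end RootSystems

end EALA

/-! Everything turns on one condition: no nonzero root is null. Nullity 0 means that the free group
Λ vanishes, which is this condition.

If it holds, every nonzero root is anisotropic and gives `sl₂`-triples. Local nilpotence (EA3) then
gives integral Cartan numbers, root strings, reflections, one-dimensional root spaces and
reducedness. The field has no order, so finiteness cannot come from a positive definite form;
instead `cartan_integer_le` bounds the Cartan integers by an arithmetic argument. A root is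
determined by its Cartan integers against a basis of anisotropic roots, so there are finitely many
roots and `E` is finite-dimensional. The roots form a root system with nondegenerate form on its
span. With tameness this gives that the roots span `H*` and that the core is `E`; connectedness
(EA4) then gives simplicity.

Conversely, let `E` be a finite-dimensional EALA with a nonzero null root δ. A Heisenberg argument
makes δ orthogonal to all roots, and finiteness of the root set makes the root spaces of δ and -δ
centralize the core. By tameness they lie in the core, so they commute with each other, although
their bracket contains `t_δ ≠ 0`.

A split simple algebra is an EALA under its Killing form: a null root δ is again orthogonal to all
roots, so `t_δ` is central and hence zero. Connectedness comes from irreducibility of the root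
system. -/

namespace EALA

variable {F E : Type*} [Field F] [LieRing E] [LieAlgebra F E]

/-! ### Representations of `sl₂` and of the Heisenberg algebra -/

section Sl2

variable {M : Type*} [AddCommGroup M] [Module F M] [LieRingModule E M] [LieModule F E M]

/-- The weight of a primitive vector on which `f` acts nilpotently is a natural number. -/
theorem _root_.IsSl2Triple.HasPrimitiveVectorWith.exists_nat_of_pow_eq_zero [CharZero F]
    {h e f : E} {t : IsSl2Triple h e f} {m : M} {μ : F} (P : t.HasPrimitiveVectorWith m μ)
    (hf : ∃ n : ℕ, ((LieModule.toEnd F E M f) ^ n) m = 0) : ∃ n : ℕ, μ = n := by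
  obtain ⟨n, hn₁, hn₂⟩ := Nat.exists_not_and_succ_of_not_zero_of_exists P.ne_zero hf
  refine ⟨n, ?_⟩
  have := P.lie_e_pow_succ_toEnd_f n
  rw [hn₂, lie_zero, eq_comm, smul_eq_zero_iff_left hn₁, mul_eq_zero, sub_eq_zero] at this
  exact this.resolve_left <| Nat.cast_add_one_ne_zero n

/-- If `e` acts nilpotently on a weight vector `m`, then the last non-zero `e ^ k m` is primitive. -/
theorem _root_.IsSl2Triple.exists_primitive_pow {h e f : E} (t : IsSl2Triple h e f) {m : M} {μ : F}
    (hm : m ≠ 0) (hμ : ⁅h, m⁆ = μ • m) (he : ∃ n : ℕ, ((LieModule.toEnd F E M e) ^ n) m = 0) :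
    ∃ k : ℕ, t.HasPrimitiveVectorWith (((LieModule.toEnd F E M e) ^ k) m) (μ + 2 * k) := by
  obtain ⟨n, hn₁, hn₂⟩ := Nat.exists_not_and_succ_of_not_zero_of_exists
    (p := fun n => ((LieModule.toEnd F E M e) ^ n) m = 0) hm he
  exact ⟨n, hn₁, t.lie_h_pow_toEnd_e hμ n, by
    rw [IsSl2Triple.lie_e_pow_toEnd_e]; exact hn₂⟩

/-- In a representation of the Heisenberg algebra `⁅e, f⁆ = c`, with `c` central, on which `f` acts
nilpotently, a vector killed by `e` on which `c` acts by a non-zero scalar vanishes. -/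
theorem scalar_eq_zero_of_heisenberg [CharZero F] {e f c : E} (hc : ⁅e, f⁆ = c) (hcf : ⁅c, f⁆ = 0)
    {m : M} (hm : m ≠ 0) {μ : F} (hμ : ⁅c, m⁆ = μ • m) (he : ⁅e, m⁆ = 0)
    (hf : ∃ n : ℕ, ((LieModule.toEnd F E M f) ^ n) m = 0) : μ = 0 := by
  have hcn (n : ℕ) : ⁅c, ((LieModule.toEnd F E M f) ^ n) m⁆ =
      μ • ((LieModule.toEnd F E M f) ^ n) m := by
    induction n with
    | zero => simpa using hμ
    | succ n ih =>
      rw [pow_succ', Module.End.mul_apply, LieModule.toEnd_apply_apply, leibniz_lie c, hcf, ih,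
        zero_lie, zero_add, lie_smul]
  have hen (n : ℕ) : ⁅e, ((LieModule.toEnd F E M f) ^ (n + 1)) m⁆ =
      ((n + 1) * μ) • ((LieModule.toEnd F E M f) ^ n) m := by
    induction n with
    | zero => simp [leibniz_lie e, hc, he, hμ]
    | succ n ih =>
      rw [pow_succ', Module.End.mul_apply, LieModule.toEnd_apply_apply, leibniz_lie e, hc, hcn, ih,
        lie_smul, ← LieModule.toEnd_apply_apply F E M f, ← Module.End.mul_apply, ← pow_succ',
        ← add_smul]
      congr 1
      push_cast
      ring
  obtain ⟨n, hn₁, hn₂⟩ := Nat.exists_not_and_succ_of_not_zero_of_exists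
    (p := fun n => ((LieModule.toEnd F E M f) ^ n) m = 0) hm hf
  have := hen n
  rw [hn₂, lie_zero, eq_comm, smul_eq_zero_iff_left hn₁, mul_eq_zero] at this
  exact this.resolve_left <| Nat.cast_add_one_ne_zero n

end Sl2

/-! ### The root grading -/

section RootSpaces

variable {H : LieSubalgebra F E}

theorem lie_mem_rootSpace {α β : Dual F H} {x y : E} (hx : x ∈ rootSpace H α)
    (hy : y ∈ rootSpace H β) : ⁅x, y⁆ ∈ rootSpace H (α + β) := by
  intro k
  rw [leibniz_lie, hx k, hy k, smul_lie, lie_smul, ← add_smul, LinearMap.add_apply]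

theorem pow_ad_mem_rootSpace {α β : Dual F H} {x y : E} (hx : x ∈ rootSpace H α)
    (hy : y ∈ rootSpace H β) (n : ℕ) :
    ((LieModule.toEnd F E E x) ^ n) y ∈ rootSpace H (β + n • α) := by
  induction n with
  | zero => simpa using hy
  | succ n ih =>
    rw [pow_succ', Module.End.mul_apply, LieModule.toEnd_apply_apply]
    convert! lie_mem_rootSpace hx ih using 2
    rw [succ_nsmul]; abel

theorem mem_roots_of_mem {α : Dual F H} {x : E} (hx : x ∈ rootSpace H α) (h0 : x ≠ 0) :
    α ∈ roots H := fun h => h0 (by rwa [h, Submodule.mem_bot] at hx)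

theorem exists_ne_zero_of_mem_roots {α : Dual F H} (hα : α ∈ roots H) :
    ∃ x ∈ rootSpace H α, x ≠ 0 := (Submodule.ne_bot_iff _).1 hα

theorem exists_apply_ne_zero {α : Dual F H} (hα : α ≠ 0) : ∃ k : H, α k ≠ 0 := by
  by_contra hc
  push Not at hc
  exact hα (LinearMap.ext hc)

/-- A submodule stable under `H` contains the components of its elements. -/
theorem components_mem {N : Submodule F E} (hN : ∀ (k : H), ∀ x ∈ N, ⁅(k : E), x⁆ ∈ N)
    (s : Finset (Dual F H)) (v : Dual F H → E) (hv : ∀ α ∈ s, v α ∈ rootSpace H α)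
    (hsum : ∑ α ∈ s, v α ∈ N) : ∀ α ∈ s, v α ∈ N := by
  classical
  induction s using Finset.induction_on generalizing v with
  | empty => simp
  | insert β s hβ ih =>
    have key : ∀ α ∈ s, v α ∈ N := by
      intro α hα
      have hne : α - β ≠ 0 := by
        intro h
        rw [sub_eq_zero] at h
        exact hβ (h ▸ hα)
      -- Applying `ad k - β(k)` removes the β-component and multiplies the α-component by `(α -
      -- β)(k) ≠ 0`.
      obtain ⟨k, hk⟩ := exists_apply_ne_zero hne
      have h1 := ih (fun γ => (γ - β) k • v γ)
        (fun γ hγ => Submodule.smul_mem _ _ (hv γ (Finset.mem_insert_of_mem hγ))) (by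
          have h2 := N.sub_mem (hN k _ hsum) (N.smul_mem (β k) hsum)
          rw [Finset.sum_insert hβ, lie_add, hv β (Finset.mem_insert_self _ _) k, smul_add,
            add_sub_add_left_eq_sub, lie_sum, Finset.smul_sum, ← Finset.sum_sub_distrib] at h2
          convert h2 using 2 with γ hγ
          rw [hv γ (Finset.mem_insert_of_mem hγ) k, LinearMap.sub_apply, sub_smul]) α hα
      exact (N.smul_mem_iff hk).1 h1
    intro α hα
    rcases Finset.mem_insert.1 hα with rfl | hα
    · rw [Finset.sum_insert hβ] at hsum
      exact (N.add_mem_iff_left (N.sum_mem key)).1 hsum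
    · exact key α hα

/-- Every element of the sum of the root spaces has components. -/
theorem exists_components (htop : ⨆ α : Dual F H, rootSpace H α = ⊤) (x : E) :
    ∃ (s : Finset (Dual F H)) (v : Dual F H → E),
      (∀ α, v α ∈ rootSpace H α) ∧ ∑ α ∈ s, v α = x := by
  have hx : x ∈ ⨆ α : Dual F H, rootSpace H α := by rw [htop]; trivial
  obtain ⟨f, hf⟩ := (Submodule.mem_iSup_iff_exists_finsupp _ _).1 hx
  exact ⟨f.support, f, hf.1, hf.2⟩

/-- A submodule containing all root spaces is everything. -/
theorem forall_of_rootSpace (htop : ⨆ α : Dual F H, rootSpace H α = ⊤) {N : Submodule F E}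
    (hN : ∀ α ∈ roots H, rootSpace H α ≤ N) (x : E) : x ∈ N := by
  have : ⨆ α : Dual F H, rootSpace H α ≤ N := iSup_le fun α => by
    by_cases h : rootSpace H α = ⊥
    · simp [h]
    · exact hN α h
  rw [htop] at this
  exact this trivial

end RootSpaces

/-! ### Consequences of the invariant form -/

namespace IsToralPair

variable {H : LieSubalgebra F E} {B : LinearMap.BilinForm F E} (h : IsToralPair H B)
include h

theorem dualForm_apply_left (α β : Dual F H) : h.dualForm α β = α (h.t β) := by
  rw [dualForm_apply, h.t_spec]

theorem dualForm_comm (α β : Dual F H) : h.dualForm α β = h.dualForm β α := by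
  rw [dualForm_apply, dualForm_apply, h.symm]

theorem coe_mem_rootSpace_zero (k : H) : (k : E) ∈ rootSpace H 0 := by
  rw [h.selfCentralizing]; exact k.2

theorem zero_mem_roots : (0 : Dual F H) ∈ roots H := by
  intro h0
  rw [h.selfCentralizing] at h0
  exact h.nontrivial (by ext x; rw [← LieSubalgebra.mem_toSubmodule, h0]; simp)

theorem form_eq_zero {α β : Dual F H} (hαβ : α + β ≠ 0) {x y : E} (hx : x ∈ rootSpace H α)
    (hy : y ∈ rootSpace H β) : B x y = 0 := by
  obtain ⟨k, hk⟩ := exists_apply_ne_zero hαβ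
  have h1 := h.invariant x k y
  rw [← lie_skew, hx k, hy k] at h1
  simp only [map_neg, map_smul, LinearMap.neg_apply, LinearMap.smul_apply, smul_eq_mul] at h1
  have h2 : (α + β) k * B x y = 0 := by rw [LinearMap.add_apply]; linear_combination -h1
  exact (mul_eq_zero.1 h2).resolve_left hk

/-- By `form_eq_zero`, `x` is orthogonal to every root space except that of `-α`, so nondegeneracy
gives a partner there, which can be rescaled. -/
theorem exists_form_eq {α : Dual F H} {x : E} (hx : x ∈ rootSpace H α) (h0 : x ≠ 0) (c : F) :
    ∃ y ∈ rootSpace H (-α), B x y = c := by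
  have : ∃ y ∈ rootSpace H (-α), B x y ≠ 0 := by
    by_contra! hc
    refine h0 (h.nondegenerate x fun y => ?_)
    refine forall_of_rootSpace h.iSup_eq_top (N := LinearMap.ker (B x)) (fun β _ y hy => ?_) y
    rw [LinearMap.mem_ker]
    by_cases hβ : α + β = 0
    · rw [← neg_eq_of_add_eq_zero_right hβ] at hy
      exact hc y hy
    · exact h.form_eq_zero hβ hx hy
  obtain ⟨y, hy, hxy⟩ := this
  exact ⟨(c / B x y) • y, Submodule.smul_mem _ _ hy, by simp [hxy]⟩

theorem neg_mem_roots {α : Dual F H} (hα : α ∈ roots H) : -α ∈ roots H := by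
  obtain ⟨x, hx, h0⟩ := exists_ne_zero_of_mem_roots hα
  obtain ⟨y, hy, hxy⟩ := h.exists_form_eq hx h0 1
  refine mem_roots_of_mem hy ?_
  rintro rfl
  simp at hxy

/-- The bracket has weight 0, so it lies in `H`; by invariance both sides pair with `k ∈ H` to `B x
y * α k`, and the form is nondegenerate on `H`. -/
theorem lie_eq_smul_t {α : Dual F H} {x y : E} (hx : x ∈ rootSpace H α)
    (hy : y ∈ rootSpace H (-α)) : ⁅x, y⁆ = B x y • (h.t α : E) := by
  have h0 := lie_mem_rootSpace hx hy
  rw [add_neg_cancel, h.selfCentralizing] at h0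
  have hz : (⟨⁅x, y⁆, h0⟩ - B x y • h.t α : H) = 0 := by
    refine h.nondegenerate_restrict.1 _ fun k => ?_
    have h1 := h.invariant x y k
    rw [← lie_skew y, hy k] at h1
    change B (⁅x, y⁆ - B x y • (h.t α : E)) k = 0
    simp only [map_sub, LinearMap.sub_apply, map_smul, LinearMap.smul_apply, h1, h.t_spec,
      smul_eq_mul, map_neg, LinearMap.neg_apply]
    ring
  simpa [sub_eq_zero] using congrArg (Subtype.val) hz

theorem lie_t_rootSpace {β : Dual F H} {x : E} (hx : x ∈ rootSpace H β) (α : Dual F H) :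
    ⁅(h.t α : E), x⁆ = h.dualForm β α • x := by
  rw [hx, dualForm_apply_left]

theorem neg_mem_anisotropicRoots {α : Dual F H} (hα : α ∈ h.anisotropicRoots) :
    -α ∈ h.anisotropicRoots := ⟨h.neg_mem_roots hα.1, by simpa using hα.2⟩

variable [CharZero F]

theorem exists_isSl2Triple {α : Dual F H} (hα : h.dualForm α α ≠ 0) {x : E}
    (hx : x ∈ rootSpace H α) (h0 : x ≠ 0) :
    ∃ y ∈ rootSpace H (-α),
      IsSl2Triple ((2 / h.dualForm α α) • (h.t α : E)) x y := by
  obtain ⟨y, hy, hxy⟩ := h.exists_form_eq hx h0 (2 / h.dualForm α α)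
  refine ⟨y, hy, ?_, ?_, ?_, ?_⟩
  · intro hz
    rcases smul_eq_zero.1 hz with hz | hz
    · simp [hα] at hz
    · rw [dualForm_apply, hz] at hα
      simp at hα
  · rw [h.lie_eq_smul_t hx hy, hxy]
  · rw [smul_lie, h.lie_t_rootSpace hx, smul_smul, div_mul_cancel₀ _ hα, ofNat_smul_eq_nsmul]
  · rw [smul_lie, h.lie_t_rootSpace hy, smul_smul, map_neg, LinearMap.neg_apply, mul_neg,
      div_mul_cancel₀ _ hα, neg_smul, ofNat_smul_eq_nsmul]

end IsToralPair

end EALA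

namespace EALA

variable {F E : Type*} [Field F] [LieRing E] [LieAlgebra F E]

/-! ### Root strings, multiplicity one and reducedness -/

namespace IsEALAForm

variable {H : LieSubalgebra F E} {B : LinearMap.BilinForm F E} (h : IsEALAForm H B)
include h

theorem ad_pow_eq_zero {α : Dual F H} (hα : α ∈ h.toral.anisotropicRoots) {x : E}
    (hx : x ∈ rootSpace H α) (y : E) : ∃ n : ℕ, ((LieModule.toEnd F E E x) ^ n) y = 0 :=
  h.locallyNilpotent α hα x hx y

theorem anisotropicRoots_nonempty : h.toral.anisotropicRoots.Nonempty := by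
  by_contra hc
  rw [Set.not_nonempty_iff_eq_empty] at hc
  have hcore : h.toral.core = ⊥ := by simp [IsToralPair.core, hc]
  refine h.toral.nontrivial ((LieSubalgebra.eq_bot_iff H).2 fun x _ => ?_)
  have := h.tame x (by rw [hcore]; intro y hy; rw [(LieSubalgebra.mem_bot y).1 hy, lie_zero])
  rwa [hcore, LieSubalgebra.mem_bot] at this

variable [CharZero F]

/-- Every root vector can be raised to a primitive vector, of integral weight. -/
theorem exists_primitive {α β : Dual F H} (hα : α ∈ h.toral.anisotropicRoots) {e f y : E}
    (he : e ∈ rootSpace H α) (hf : f ∈ rootSpace H (-α))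
    (t : IsSl2Triple ((2 / h.toral.dualForm α α) • (h.toral.t α : E)) e f)
    (hy : y ∈ rootSpace H β) (h0 : y ≠ 0) :
    ∃ (k n : ℕ) (p : E), p ∈ rootSpace H (β + k • α) ∧ t.HasPrimitiveVectorWith p (n : F) ∧
      2 * h.toral.dualForm β α = (n - 2 * k) * h.toral.dualForm α α := by
  obtain ⟨k, P⟩ := t.exists_primitive_pow (F := F) (μ := 2 / h.toral.dualForm α α *
    h.toral.dualForm β α) h0 (by rw [smul_lie, h.toral.lie_t_rootSpace hy, smul_smul])
    (h.ad_pow_eq_zero hα he y)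
  obtain ⟨n, hn⟩ := P.exists_nat_of_pow_eq_zero
    (h.ad_pow_eq_zero (h.toral.neg_mem_anisotropicRoots hα) hf _)
  refine ⟨k, n, _, pow_ad_mem_rootSpace he hy k, hn ▸ P, ?_⟩
  have h2 := hα.2
  field_simp at hn
  linear_combination hn

/-- A vector killed by the lowering operator has a weight that is not positive. -/
theorem eq_zero_of_lie_eq_zero {α β : Dual F H} (hα : α ∈ h.toral.anisotropicRoots) {e f y : E}
    (he : e ∈ rootSpace H α)
    (t : IsSl2Triple ((2 / h.toral.dualForm α α) • (h.toral.t α : E)) e f)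
    (hy : y ∈ rootSpace H β) (hfy : ⁅f, y⁆ = 0) {n : ℕ}
    (hn : 2 * h.toral.dualForm β α = (n + 1) * h.toral.dualForm α α) : y = 0 := by
  by_contra h0
  -- For the reversed triple `y` is primitive of weight `-(n + 1)`, which would have to be a natural
  -- number.
  have P : t.symm.HasPrimitiveVectorWith y (-(2 / h.toral.dualForm α α *
    h.toral.dualForm β α)) := ⟨h0, by
      rw [neg_lie, smul_lie, h.toral.lie_t_rootSpace hy, smul_smul, neg_smul], hfy⟩
  obtain ⟨m, hm⟩ := P.exists_nat_of_pow_eq_zero (h.ad_pow_eq_zero hα he y)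
  have h2 := hα.2
  have h3 : ((m + n + 1 : ℕ) : F) = 0 := by
    push_cast
    rw [← hm, div_mul_eq_mul_div, hn]
    field_simp
    ring
  exact absurd (Nat.cast_eq_zero.1 h3) (by omega)

theorem exists_int {α β : Dual F H} (hα : α ∈ h.toral.anisotropicRoots) (hβ : β ∈ roots H) :
    ∃ z : ℤ, 2 * h.toral.dualForm β α = z * h.toral.dualForm α α := by
  obtain ⟨x, hx, hx0⟩ := exists_ne_zero_of_mem_roots hα.1
  obtain ⟨y, hy, hy0⟩ := exists_ne_zero_of_mem_roots hβ
  obtain ⟨f, hf, t⟩ := h.toral.exists_isSl2Triple hα.2 hx hx0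
  obtain ⟨k, n, p, -, -, hp⟩ := h.exists_primitive hα hx hf t hy hy0
  exact ⟨n - 2 * k, by push_cast; exact hp⟩

/-- The root string through `β` contains the segment from `β` to its reflection in `α`. -/
theorem sub_mem_roots {α β : Dual F H} (hα : α ∈ h.toral.anisotropicRoots) (hβ : β ∈ roots H)
    {n : ℕ} (hn : 2 * h.toral.dualForm β α = n * h.toral.dualForm α α) {k : ℕ} (hk : k ≤ n) :
    β - k • α ∈ roots H := by
  obtain ⟨x, hx, hx0⟩ := exists_ne_zero_of_mem_roots hα.1
  obtain ⟨y, hy, hy0⟩ := exists_ne_zero_of_mem_roots hβ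
  obtain ⟨f, hf, t⟩ := h.toral.exists_isSl2Triple hα.2 hx hx0
  obtain ⟨j, m, p, hpm, hp, hmj⟩ := h.exists_primitive hα hx hf t hy hy0
  rw [hn] at hmj
  have hm : m = n + 2 * j := by
    have := mul_right_cancel₀ hα.2 hmj
    have : ((n + 2 * j : ℕ) : F) = m := by push_cast; linear_combination this
    exact (Nat.cast_injective this).symm
  -- Here `p` has root `β + j • α`, so lowering `j + k` times reaches `β - k • α`; the result is
  -- nonzero because `j + k ≤ m = n + 2 * j`.
  have h1 := hp.pow_toEnd_f_ne_zero_of_eq_nat rfl (i := j + k) (by omega)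
  have h2 := mem_roots_of_mem (pow_ad_mem_rootSpace hf hpm (j + k)) h1
  convert h2 using 1
  rw [add_smul, smul_neg, smul_neg]
  abel

theorem reflection_mem_roots {α β : Dual F H} (hα : α ∈ h.toral.anisotropicRoots)
    (hβ : β ∈ roots H) {z : ℤ} (hz : 2 * h.toral.dualForm β α = z * h.toral.dualForm α α) :
    β - z • α ∈ roots H := by
  obtain ⟨n, rfl | rfl⟩ := z.eq_nat_or_neg
  · have := h.sub_mem_roots hα hβ (n := n) (by exact_mod_cast hz) le_rfl
    simpa using this
  · have := h.sub_mem_roots (h.toral.neg_mem_anisotropicRoots hα) hβ (n := n) (by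
      simp only [map_neg, LinearMap.neg_apply]
      push_cast at hz
      linear_combination -hz) le_rfl
    simpa using this

/-- Brackets with `f` are multiples of `t_α`, so some `y - c • x` is killed by `f`. Its weight is 2,
and a vector of positive weight killed by `f` vanishes. -/
theorem mem_span_singleton {α : Dual F H} (hα : α ∈ h.toral.anisotropicRoots) {x y : E}
    (hx : x ∈ rootSpace H α) (hx0 : x ≠ 0) (hy : y ∈ rootSpace H α) : ∃ c : F, y = c • x := by
  obtain ⟨f, hf, t⟩ := h.toral.exists_isSl2Triple hα.2 hx hx0
  have hBx : B x f ≠ 0 := by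
    intro h0
    have := h.toral.lie_eq_smul_t hx hf
    rw [h0, zero_smul, t.lie_e_f] at this
    exact t.h_ne_zero this
  refine ⟨B y f / B x f, sub_eq_zero.1 (h.eq_zero_of_lie_eq_zero hα hx t (β := α)
    (Submodule.sub_mem _ hy (Submodule.smul_mem _ _ hx)) ?_ (n := 1) (by norm_num))⟩
  rw [← lie_skew, sub_lie, smul_lie, h.toral.lie_eq_smul_t hx hf, h.toral.lie_eq_smul_t hy hf,
    smul_smul, div_mul_cancel₀ _ hBx, sub_self, neg_zero]

/-- Raise a vector of root `2α` to a primitive one, then lower it to root `α`. There it is a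
multiple of `x`, hence killed by `x`, whereas the `sl₂` formula says that raising it gives a nonzero
vector. -/
theorem two_smul_notMem_roots {α : Dual F H} (hα : α ∈ h.toral.anisotropicRoots) :
    (2 : ℕ) • α ∉ roots H := by
  intro h2
  obtain ⟨x, hx, hx0⟩ := exists_ne_zero_of_mem_roots hα.1
  obtain ⟨y, hy, hy0⟩ := exists_ne_zero_of_mem_roots h2
  obtain ⟨f, hf, t⟩ := h.toral.exists_isSl2Triple hα.2 hx hx0
  obtain ⟨j, m, p, hpm, hp, hmj⟩ := h.exists_primitive hα hx hf t hy hy0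
  have hm : m = 4 + 2 * j := by
    simp only [map_nsmul, LinearMap.smul_apply, nsmul_eq_mul] at hmj
    have : (4 : F) = m - 2 * j := mul_right_cancel₀ hα.2
      (by push_cast at hmj; linear_combination hmj)
    have : ((4 + 2 * j : ℕ) : F) = m := by push_cast; linear_combination this
    exact (Nat.cast_injective this).symm
  have h1 := hp.pow_toEnd_f_ne_zero_of_eq_nat rfl (i := j) (by omega)
  have h3 := pow_ad_mem_rootSpace hf hpm (j + 1)
  have h4 : (2 • α + j • α + (j + 1) • -α : Dual F H) = α := by
    rw [add_smul, smul_neg, smul_neg, one_smul, two_smul]; abel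
  rw [h4] at h3
  obtain ⟨c, hc⟩ := h.mem_span_singleton hα hx hx0 h3
  have h5 := hp.lie_e_pow_succ_toEnd_f j
  rw [hc, lie_smul, lie_self, smul_zero, eq_comm, smul_eq_zero_iff_left h1, mul_eq_zero,
    sub_eq_zero, Nat.cast_inj] at h5
  rcases h5 with h5 | h5
  · exact Nat.cast_add_one_ne_zero j h5
  · omega

/-- Proportional anisotropic roots are equal up to sign. -/
theorem eq_or_eq_neg_of_smul {α β : Dual F H} (hα : α ∈ h.toral.anisotropicRoots)
    (hβ : β ∈ h.toral.anisotropicRoots) {c : F} (hc : β = c • α) : β = α ∨ β = -α := by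
  obtain ⟨z, hz⟩ := h.exists_int hα hβ.1
  obtain ⟨w, hw⟩ := h.exists_int hβ hα.1
  have hc0 : c ≠ 0 := by
    rintro rfl
    exact hβ.2 (by simp [hc])
  subst hc
  have ha := hα.2
  simp only [map_smul, LinearMap.smul_apply, smul_eq_mul] at hz hw
  have hz' : 2 * c = z := mul_right_cancel₀ ha (by linear_combination hz)
  have hw' : 2 = w * c := mul_right_cancel₀ (mul_ne_zero hc0 ha) (by linear_combination hw)
  have hzw : w * z = 4 := by
    have : ((w * z : ℤ) : F) = (4 : ℤ) := by push_cast; rw [← hz']; linear_combination -2 * hw'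
    exact_mod_cast this
  have hmul (γ : Dual F H) (hγ : γ ∈ h.toral.anisotropicRoots) (n : F) (δ : Dual F H)
      (hδ : δ ∈ roots H) (hn : n = 2 ∨ n = -2) : δ ≠ n • γ := by
    rintro rfl
    rcases hn with rfl | rfl
    · exact h.two_smul_notMem_roots hγ (by
        rwa [← Nat.cast_smul_eq_nsmul F, Nat.cast_ofNat])
    · exact h.two_smul_notMem_roots (h.toral.neg_mem_anisotropicRoots hγ) (by
        rwa [← Nat.cast_smul_eq_nsmul F, Nat.cast_ofNat, smul_neg, ← neg_smul])
  have hdvd : z ∣ 4 := ⟨w, by rw [← hzw, mul_comm]⟩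
  have hz4 : z ≤ 4 := Int.le_of_dvd (by norm_num) hdvd
  have hz4' : -z ≤ 4 := Int.le_of_dvd (by norm_num) ((neg_dvd).2 hdvd)
  have hcz : c = z / 2 := by rw [← hz']; ring
  have hα' : α = c⁻¹ • c • α := by rw [smul_smul, inv_mul_cancel₀ hc0, one_smul]
  obtain ⟨lo, hi⟩ : -4 ≤ z ∧ z ≤ 4 := ⟨by omega, hz4⟩
  -- Since `w * z = 4`, the values 0 and ±3 are impossible; ±4 and ±1 make one root ± twice the
  -- other, and ±2 is the conclusion.
  interval_cases z
  · exact absurd rfl (hmul α hα c _ hβ.1 (Or.inr (by rw [hcz]; norm_num)))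
  · omega
  · right; rw [hcz, show ((-2 : ℤ) : F) / 2 = -1 by norm_num, neg_one_smul F α]
  · exact absurd hα' (hmul _ hβ c⁻¹ _ hα.1 (Or.inr (by rw [hcz]; norm_num)))
  · omega
  · exact absurd hα' (hmul _ hβ c⁻¹ _ hα.1 (Or.inl (by rw [hcz]; norm_num)))
  · left; rw [hcz]; norm_num
  · omega
  · exact absurd rfl (hmul α hα c _ hβ.1 (Or.inl (by rw [hcz]; norm_num)))

end IsEALAForm

end EALA

namespace EALA

variable {F E : Type*} [Field F] [LieRing E] [LieAlgebra F E]

/-! ### Finiteness when no nonzero root is null -/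

namespace IsEALAForm

variable {H : LieSubalgebra F E} {B : LinearMap.BilinForm F E} (h : IsEALAForm H B) [CharZero F]
include h

/-- If `z ≥ 7`, then `δ = β - 3α` is a nonzero root, hence anisotropic. Integrality of α against
both β and δ gives a relation between integers that forces `|n| (2z - 3) ≤ z`, which is absurd.
Subtracting α only once or twice would give too weak an estimate. -/
theorem cartan_integer_le (hN : ∀ δ ∈ roots H, h.toral.dualForm δ δ = 0 → δ = 0)
    {α β : Dual F H} (hα : α ∈ h.toral.anisotropicRoots) (hβ : β ∈ roots H) {z : ℤ}
    (hz : 2 * h.toral.dualForm β α = z * h.toral.dualForm α α) : z ≤ 6 := by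
  by_contra! hlt
  have haniso (δ : Dual F H) (hδ : δ ∈ roots H) (h0 : δ ≠ 0) : δ ∈ h.toral.anisotropicRoots :=
    ⟨hδ, fun h1 => h0 (hN δ hδ h1)⟩
  have ha := hα.2
  have hβ0 : β ≠ 0 := by
    rintro rfl
    simp only [map_zero, LinearMap.zero_apply, mul_zero, zero_eq_mul, Int.cast_eq_zero] at hz
    rcases hz with hz | hz
    · omega
    · exact ha hz
  have hδ : β - 3 • α ∈ roots H := by
    lift z to ℕ using by omega
    exact h.sub_mem_roots hα hβ (n := z) (by exact_mod_cast hz) (by omega)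
  have hδ0 : β - 3 • α ≠ 0 := by
    intro h0
    rw [sub_eq_zero] at h0
    subst h0
    simp only [map_nsmul, LinearMap.smul_apply, nsmul_eq_mul] at hz
    have h6 : (z : F) = (6 : ℤ) := mul_right_cancel₀ ha (by
      rw [← hz]; push_cast; ring)
    have := Int.cast_injective h6
    omega
  obtain ⟨n, hn⟩ := h.exists_int (haniso β hβ hβ0) hα.1
  obtain ⟨m, hm⟩ := h.exists_int (haniso _ hδ hδ0) hα.1
  have hcomm := h.toral.dualForm_comm α β
  simp only [map_sub, map_nsmul, LinearMap.sub_apply, LinearMap.smul_apply, nsmul_eq_mul,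
    hcomm] at hn hm
  push_cast at hm
  set a := h.toral.dualForm α α
  set b := h.toral.dualForm β β
  set c := h.toral.dualForm β α
  have e1 : (z : F) * a = n * b := by rw [← hz, hn]
  have e2 : ((z : F) - 6) * a = m * (b - (3 * z - 9) * a) := by
    linear_combination hm - hz - 3 * m * hz
  -- Eliminating `b = (β|β)` and cancelling `a = (α|α)` leaves a relation in ℤ, where absolute
  -- values are available.
  have e3 : (n * (z - 6) : ℤ) = m * (z - n * (3 * z - 9)) := by
    have : ((n * (z - 6) : ℤ) : F) = (m * (z - n * (3 * z - 9)) : ℤ) := by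
      refine mul_right_cancel₀ ha ?_
      push_cast
      linear_combination n * e2 - m * e1
    exact_mod_cast this
  have hn0 : n ≠ 0 := by
    rintro rfl
    simp only [Int.cast_zero, zero_mul, mul_eq_zero, Int.cast_eq_zero] at e1
    rcases e1 with e1 | e1
    · omega
    · exact ha e1
  have hle : |z - n * (3 * z - 9)| ≤ |n| * (z - 6) := by
    have h1 : |n| * (z - 6) = |m| * |z - n * (3 * z - 9)| := by
      rw [← abs_mul, ← e3, abs_mul, abs_of_pos (show 0 < z - 6 by omega)]
    have hm0 : 1 ≤ |m| := by
      refine Int.one_le_abs ?_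
      rintro rfl
      rw [zero_mul] at e3
      rcases mul_eq_zero.1 e3 with e3 | e3 <;> omega
    rw [h1]
    nlinarith [abs_nonneg (z - n * (3 * z - 9))]
  have hn1 : 1 ≤ |n| := Int.one_le_abs hn0
  have h2 : |n| * (3 * z - 9) ≤ z + |z - n * (3 * z - 9)| := by
    rw [← abs_of_pos (show 0 < 3 * z - 9 by omega), ← abs_mul,
      abs_of_pos (show 0 < 3 * z - 9 by omega)]
    have h3 := abs_sub_abs_le_abs_sub (n * (3 * z - 9)) z
    rw [abs_sub_comm, abs_of_pos (show 0 < z by omega)] at h3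
    linarith
  nlinarith

theorem abs_cartan_integer_le (hN : ∀ δ ∈ roots H, h.toral.dualForm δ δ = 0 → δ = 0)
    {α β : Dual F H} (hα : α ∈ h.toral.anisotropicRoots) (hβ : β ∈ roots H) :
    ∃ z ∈ Set.Icc (-6 : ℤ) 6, 2 * h.toral.dualForm β α = z * h.toral.dualForm α α := by
  obtain ⟨z, hz⟩ := h.exists_int hα hβ
  refine ⟨z, ⟨?_, h.cartan_integer_le hN hα hβ hz⟩, hz⟩
  have := h.cartan_integer_le hN hα (h.toral.neg_mem_roots hβ) (z := -z) (by
    simp only [map_neg, LinearMap.neg_apply]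
    push_cast
    linear_combination -hz)
  omega

/-- Two roots whose difference is orthogonal to both of them are equal. -/
theorem eq_of_sub_orthogonal (hN : ∀ δ ∈ roots H, h.toral.dualForm δ δ = 0 → δ = 0)
    {β γ : Dual F H} (hβ : β ∈ roots H) (hγ : γ ∈ h.toral.anisotropicRoots)
    (h1 : h.toral.dualForm (β - γ) β = 0) (h2 : h.toral.dualForm (β - γ) γ = 0) : β = γ := by
  have h3 : β - γ ∈ roots H := by
    -- The Cartan integer of β against γ is 2, so `β - γ` is in the string; it is a null root, hence
    -- zero.
    have := h.sub_mem_roots hγ hβ (n := 2) (k := 1) (by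
      rw [map_sub, LinearMap.sub_apply, sub_eq_zero] at h2
      rw [h2, Nat.cast_ofNat]) (by norm_num)
    rwa [one_smul] at this
  exact sub_eq_zero.1 (hN _ h3 (by rw [map_sub, h1, h2, sub_zero]))

/-- The Cartan integers against a basis chosen among the anisotropic roots take finitely many
values. If β and γ share them, `β - γ` is orthogonal to the whole span, in particular to β and γ, so
they agree even without nondegeneracy on the span. -/
theorem finite_anisotropicRoots (hN : ∀ δ ∈ roots H, h.toral.dualForm δ δ = 0 → δ = 0) :
    h.toral.anisotropicRoots.Finite := by
  have := h.toral.finiteDimensional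
  obtain ⟨b, hb, hspan, hli⟩ := exists_linearIndependent F h.toral.anisotropicRoots
  have : Finite b := hli.setFinite
  have hex (β : Dual F H) (α : b) : ∃ z : ℤ, β ∈ roots H → z ∈ Set.Icc (-6 : ℤ) 6 ∧
      2 * h.toral.dualForm β α = z * h.toral.dualForm α α := by
    by_cases hβ : β ∈ roots H
    · obtain ⟨z, hz⟩ := h.abs_cartan_integer_le hN (hb α.2) hβ
      exact ⟨z, fun _ => hz⟩
    · exact ⟨0, fun h => absurd h hβ⟩
  choose f hf using hex
  refine Set.Finite.of_injOn (f := f) (t := Set.univ.pi fun _ => Set.Icc (-6 : ℤ) 6)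
    (fun β hβ α _ => (hf β α hβ.1).1) ?_ (Set.Finite.pi fun _ => Set.finite_Icc _ _)
  intro β hβ γ hγ hβγ
  have hle : Submodule.span F h.toral.anisotropicRoots ≤
      LinearMap.ker (h.toral.dualForm (β - γ)) := by
    rw [← hspan, Submodule.span_le]
    intro α hα
    have h1 := (hf β ⟨α, hα⟩ hβ.1).2
    rw [hβγ, ← (hf γ ⟨α, hα⟩ hγ.1).2] at h1
    simpa [sub_eq_zero] using h1
  have h1 : h.toral.dualForm (β - γ) β = 0 := hle (Submodule.subset_span hβ)
  have h2 : h.toral.dualForm (β - γ) γ = 0 := hle (Submodule.subset_span hγ)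
  exact h.eq_of_sub_orthogonal hN hβ.1 hγ h1 h2

theorem finiteDimensional_rootSpace {α : Dual F H} (hα : α ∈ h.toral.anisotropicRoots) :
    FiniteDimensional F (rootSpace H α) := by
  obtain ⟨x, hx, hx0⟩ := exists_ne_zero_of_mem_roots hα.1
  refine Submodule.finiteDimensional_of_le (S₂ := Submodule.span F {x}) fun y hy => ?_
  obtain ⟨c, rfl⟩ := h.mem_span_singleton hα hx hx0 hy
  exact Submodule.smul_mem _ _ (Submodule.mem_span_singleton_self x)

theorem finite_roots (hN : ∀ δ ∈ roots H, h.toral.dualForm δ δ = 0 → δ = 0) :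
    (roots H).Finite :=
  ((h.finite_anisotropicRoots hN).insert 0).subset fun α hα => by
    by_cases h0 : α = 0
    · exact Or.inl h0
    · exact Or.inr ⟨hα, fun h1 => h0 (hN α hα h1)⟩

theorem finiteDimensional_of_nullRoots (hN : ∀ δ ∈ roots H, h.toral.dualForm δ δ = 0 → δ = 0) :
    FiniteDimensional F E := by
  have : Finite (roots H) := h.finite_roots hN
  have hfd (α : roots H) : FiniteDimensional F (rootSpace H α.1) := by
    by_cases h0 : α.1 = 0
    · rw [h0, h.toral.selfCentralizing]
      exact h.toral.finiteDimensional
    · exact h.finiteDimensional_rootSpace ⟨α.2, fun h1 => h0 (hN _ α.2 h1)⟩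
  have htop : ⨆ α : roots H, rootSpace H α.1 = ⊤ := eq_top_iff.2 fun x _ =>
    forall_of_rootSpace h.toral.iSup_eq_top (fun α hα => le_iSup
      (fun α : roots H => rootSpace H α.1) ⟨α, hα⟩) x
  have : FiniteDimensional F (⨆ α : roots H, rootSpace H α.1 : Submodule F E) :=
    Submodule.finite_iSup _
  rw [htop] at this
  exact Module.finite_def.2 (Module.Finite.iff_fg.1 this)

end IsEALAForm

/-! ### Finitely many roots exclude nonzero null roots -/

section FiniteDimensional

variable {H : LieSubalgebra F E}

theorem finite_roots_of_finiteDimensional [FiniteDimensional F E]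
    (hind : iSupIndep (rootSpace H)) : (roots H).Finite :=
  WellFoundedGT.finite_ne_bot_of_iSupIndep hind

/-- In the finite-dimensional case every root vector of non-zero weight is ad-nilpotent. -/
theorem pow_toEnd_eq_zero_of_finite [CharZero F] (hfin : (roots H).Finite)
    (htop : ⨆ α : Dual F H, rootSpace H α = ⊤) {α : Dual F H} (hα : α ≠ 0) {x : E}
    (hx : x ∈ rootSpace H α) (y : E) : ∃ n : ℕ, ((LieModule.toEnd F E E x) ^ n) y = 0 := by
  have hmono (y : E) {n m : ℕ} (hnm : n ≤ m) (h0 : ((LieModule.toEnd F E E x) ^ n) y = 0) :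
      ((LieModule.toEnd F E E x) ^ m) y = 0 := by
    rw [← Nat.sub_add_cancel hnm, pow_add, Module.End.mul_apply, h0, map_zero]
  have hy : y ∈ ⨆ α : Dual F H, rootSpace H α := by rw [htop]; trivial
  induction hy using Submodule.iSup_induction' with
  | zero => exact ⟨0, by simp⟩
  | add a b _ _ ha hb =>
    obtain ⟨n, hn⟩ := ha
    obtain ⟨m, hm⟩ := hb
    exact ⟨max n m, by rw [map_add, hmono a (le_max_left _ _) hn, hmono b (le_max_right _ _) hm,
      add_zero]⟩
  | mem β y hy =>
    by_contra! hne
    have hinj : Function.Injective fun n : ℕ => β + n • α := by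
      intro n m hnm
      have := add_left_cancel hnm
      rw [← Nat.cast_smul_eq_nsmul F, ← Nat.cast_smul_eq_nsmul F] at this
      exact Nat.cast_injective (smul_left_injective F hα this)
    exact Set.infinite_of_injective_forall_mem hinj
      (fun n => mem_roots_of_mem (pow_ad_mem_rootSpace hx hy n) (hne n)) hfin

end FiniteDimensional

namespace IsToralPair

variable {H : LieSubalgebra F E} {B : LinearMap.BilinForm F E} (h : IsToralPair H B) [CharZero F]
include h

/-- A null root of a toral pair with finitely many roots is orthogonal to all roots. -/
theorem dualForm_eq_zero_of_null (hfin : (roots H).Finite) {δ : Dual F H} (hδ : δ ∈ roots H)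
    (hδ0 : δ ≠ 0) (hnull : h.dualForm δ δ = 0) {β : Dual F H} (hβ : β ∈ roots H) :
    h.dualForm β δ = 0 := by
  obtain ⟨x, hx, hx0⟩ := exists_ne_zero_of_mem_roots hδ
  obtain ⟨y, hy, hxy⟩ := h.exists_form_eq hx hx0 1
  obtain ⟨v, hv, hv0⟩ := exists_ne_zero_of_mem_roots hβ
  have hc : ⁅x, y⁆ = (h.t δ : E) := by rw [h.lie_eq_smul_t hx hy, hxy, one_smul]
  obtain ⟨n, hn₁, hn₂⟩ := Nat.exists_not_and_succ_of_not_zero_of_exists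
    (p := fun n => ((LieModule.toEnd F E E x) ^ n) v = 0) hv0
    (pow_toEnd_eq_zero_of_finite hfin h.iSup_eq_top hδ0 hx v)
  have hw := h.lie_t_rootSpace (pow_ad_mem_rootSpace hx hv n) δ
  -- As δ is null, `t_δ` is central in the algebra spanned by `x, y, t_δ`, and its eigenvalue `(β +
  -- nδ|δ)` is `(β|δ)`.
  have := scalar_eq_zero_of_heisenberg hc (by
      rw [h.lie_t_rootSpace hy, map_neg, LinearMap.neg_apply, hnull, neg_zero, zero_smul])
    hn₁ hw (by rw [pow_succ', Module.End.mul_apply] at hn₂; exact hn₂)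
    (pow_toEnd_eq_zero_of_finite hfin h.iSup_eq_top (neg_ne_zero.2 hδ0) hy _)
  simpa [hnull] using this

end IsToralPair

namespace IsEALAForm

variable {H : LieSubalgebra F E} {B : LinearMap.BilinForm F E} (h : IsEALAForm H B) [CharZero F]
include h

/-- A nonzero bracket makes `α + δ` a root. Reflecting `α + nδ` in `α + (n+1)δ`, with Cartan integer
2, gives `-(α + (n+2)δ)`, so the ray `α + ℕδ` would consist of roots. -/
theorem lie_eq_zero_of_null (hfin : (roots H).Finite) {δ : Dual F H} (hδ : δ ∈ roots H)
    (hδ0 : δ ≠ 0) (hnull : h.toral.dualForm δ δ = 0) {α : Dual F H}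
    (hα : α ∈ h.toral.anisotropicRoots) {x y : E} (hx : x ∈ rootSpace H δ)
    (hy : y ∈ rootSpace H α) : ⁅x, y⁆ = 0 := by
  by_contra h0
  have horth := h.toral.dualForm_eq_zero_of_null hfin hδ hδ0 hnull hα.1
  have horth' : h.toral.dualForm δ α = 0 := by rw [h.toral.dualForm_comm, horth]
  have hnorm (n : ℕ) : h.toral.dualForm (α + n • δ) (α + n • δ) = h.toral.dualForm α α := by
    simp [horth, horth', hnull]
  have hroot (n : ℕ) : α + n • δ ∈ roots H ∧ α + (n + 1) • δ ∈ roots H := by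
    induction n with
    | zero =>
      refine ⟨by simpa using hα.1, mem_roots_of_mem ?_ h0⟩
      have := lie_mem_rootSpace hx hy
      rwa [zero_add, one_smul, add_comm α]
    | succ n ih =>
      refine ⟨ih.2, ?_⟩
      have h1 := h.reflection_mem_roots (α := α + (n + 1) • δ) (β := α + n • δ) (z := 2)
        ⟨ih.2, by rw [hnorm]; exact hα.2⟩ ih.1 (by
          simp [horth, horth', hnull])
      convert! h.toral.neg_mem_roots h1 using 1
      simp only [add_smul, one_smul, two_smul]
      abel
  have hinj : Function.Injective fun n : ℕ => α + n • δ := by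
    intro n m hnm
    have := add_left_cancel hnm
    rw [← Nat.cast_smul_eq_nsmul F, ← Nat.cast_smul_eq_nsmul F] at this
    exact Nat.cast_injective (smul_left_injective F hδ0 this)
  exact Set.infinite_of_injective_forall_mem hinj (fun n => (hroot n).1) hfin

omit [CharZero F] in
/-- An element commuting with the anisotropic root vectors commutes with the core. -/
theorem lie_core_eq_zero {x : E}
    (hx : ∀ α ∈ h.toral.anisotropicRoots, ∀ y ∈ rootSpace H α, ⁅x, y⁆ = 0) :
    ∀ y ∈ h.toral.core, ⁅x, y⁆ = 0 := by
  intro y hy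
  let C : LieSubalgebra F E :=
    { LinearMap.ker (LieModule.toEnd F E E x) with
      lie_mem' := by
        intro a b ha hb
        change ⁅x, a⁆ = 0 at ha
        change ⁅x, b⁆ = 0 at hb
        change ⁅x, ⁅a, b⁆⁆ = 0
        rw [leibniz_lie, ha, hb, zero_lie, lie_zero, add_zero] }
  have hle : h.toral.core ≤ C := by
    refine LieSubalgebra.lieSpan_le.2 fun y hy => ?_
    simp only [Set.mem_iUnion] at hy
    obtain ⟨α, hα, hy⟩ := hy
    exact hx α hα y hy
  exact hle hy

/-- Root vectors `x, y` for δ and -δ commute with the core. Tameness puts `y` into the core, so `⁅x,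
y⁆ = 0`; yet `y` can be scaled so that this bracket is `t_δ`. -/
theorem null_eq_zero_of_finite (hfin : (roots H).Finite) :
    ∀ δ ∈ roots H, h.toral.dualForm δ δ = 0 → δ = 0 := by
  intro δ hδ hnull
  by_contra hδ0
  have key {δ : Dual F H} (hδ : δ ∈ roots H) (hδ0 : δ ≠ 0) (hnull : h.toral.dualForm δ δ = 0)
      {x : E} (hx : x ∈ rootSpace H δ) : ∀ y ∈ h.toral.core, ⁅x, y⁆ = 0 :=
    h.lie_core_eq_zero fun α hα y hy => h.lie_eq_zero_of_null hfin hδ hδ0 hnull hα hx hy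
  obtain ⟨x, hx, hx0⟩ := exists_ne_zero_of_mem_roots hδ
  obtain ⟨y, hy, hxy⟩ := h.toral.exists_form_eq hx hx0 1
  have hy' := h.tame y (key (h.toral.neg_mem_roots hδ) (neg_ne_zero.2 hδ0) (by simpa using hnull) hy)
  have h1 := key hδ hδ0 hnull hx y hy'
  rw [h.toral.lie_eq_smul_t hx hy, hxy, one_smul] at h1
  exact hδ0 (h.toral.t.map_eq_zero_iff.1 (Subtype.ext h1))

end IsEALAForm

end EALA

/-! ### From root data to root pairings -/

namespace EALA

variable {F : Type*} [Field F] {Y : Type*} [AddCommGroup Y] [Module F Y]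

/-- A finite set `S` containing `0`, with functionals `φ a` that make it an irreducible reduced
root system. -/
structure IsRootData (S : Set Y) (φ : Y → Dual F Y) : Prop where
  zero_mem : (0 : Y) ∈ S
  finite : S.Finite
  span_eq_top : Submodule.span F S = ⊤
  two : ∀ a ∈ S \ {0}, φ a a = 2
  injOn : Set.InjOn φ (S \ {0})
  reflection_mem : ∀ a ∈ S \ {0}, ∀ b ∈ S, b - φ a b • a ∈ S
  exists_int : ∀ a ∈ S \ {0}, ∀ b ∈ S, ∃ z : ℤ, (z : F) = φ a b
  reduced : ∀ a ∈ S \ {0}, ∀ b ∈ S \ {0}, ∀ c : F, b = c • a → b = a ∨ b = -a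
  connected : ∀ S₁ S₂ : Set Y, S \ {0} = S₁ ∪ S₂ → (∀ a ∈ S₁, ∀ b ∈ S₂, φ b a = 0) →
    S₁ = ∅ ∨ S₂ = ∅
  nonempty : (S \ {0}).Nonempty

namespace IsRootData

variable {S : Set Y} {φ : Y → Dual F Y} (d : IsRootData S φ)
include d

theorem finite_diff : Finite (S \ {0} : Set Y) := (d.finite.subset Set.sdiff_subset).to_subtype

theorem span_range_eq_top :
    Submodule.span F (Set.range (Function.Embedding.subtype (· ∈ S \ {0}))) = ⊤ := by
  rw [← d.span_eq_top]
  refine le_antisymm (Submodule.span_mono ?_) (Submodule.span_le.2 fun a ha => ?_)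
  · rintro _ ⟨a, rfl⟩
    exact a.2.1
  · by_cases h0 : a = 0
    · rw [h0]; exact Submodule.zero_mem _
    · exact Submodule.subset_span ⟨⟨a, ha, h0⟩, rfl⟩

theorem finiteDimensional : FiniteDimensional F Y :=
  Module.finite_def.2 (d.span_eq_top ▸ Submodule.fg_span d.finite)

theorem exists_rootPairing [CharZero F] :
    ∃ P : RootPairing (S \ {0} : Set Y) F Y (Dual F Y),
      (∀ a, P.root a = (a : Y)) ∧ (∀ a x, P.coroot' a x = φ a x) ∧ P.IsRootSystem ∧
        P.IsCrystallographic := by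
  have := d.finiteDimensional
  have := d.finite_diff
  have hint : ∀ a b : (S \ {0} : Set Y), ∃ z : ℤ, z = φ b a := fun a b =>
    d.exists_int b b.2 a a.2.1
  refine ⟨RootPairing.mk'' (Dual.eval F Y) (Function.Embedding.subtype (· ∈ S \ {0}))
    ⟨fun a => φ a, fun a b hab => Subtype.ext (d.injOn a.2 b.2 hab)⟩
    (fun a => d.two a a.2) ?_ d.span_range_eq_top, fun a => rfl, fun a x => rfl,
    RootPairing.isRootSystem_mk'' hint, ⟨hint⟩⟩
  rintro a _ ⟨b, rfl⟩
  have h1 := d.reflection_mem a a.2 b b.2.1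
  refine ⟨⟨b - φ a b • (a : Y), h1, fun h0 => b.2.2 ?_⟩, rfl⟩
  rw [Set.mem_singleton_iff, sub_eq_zero] at h0
  -- If the reflection of `b` were 0, then `b = c • a` with `c = φ a b = 2c`, so `b = 0`.
  have h2 : φ a b = φ a b * 2 := by
    conv_lhs => rw [h0, map_smul, d.two a a.2, smul_eq_mul]
  have h3 : φ a b = 0 := by linear_combination -h2
  rw [Set.mem_singleton_iff, h0, h3, zero_smul]

theorem eq_zero_of_forall [CharZero F] {x : Y} (hx : ∀ a ∈ S \ {0}, φ a x = 0) : x = 0 := by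
  obtain ⟨P, -, hP, hr, -⟩ := d.exists_rootPairing
  exact P.eq_zero_iff_forall_coroot'_eq_zero.2 fun a => by rw [hP, hx a a.2]

theorem isIrreducibleReducedRootSystem [CharZero F] :
    IsIrreducibleReducedRootSystem (F := F) S := by
  obtain ⟨P, hroot, hP, hr, hc⟩ := d.exists_rootPairing
  refine ⟨d.zero_mem, d.finite, P, hroot, hr, hc, ⟨fun a b hab => ?_⟩, ?_⟩
  · rw [hroot, hroot] at hab ⊢
    rw [LinearIndependent.pair_iff' a.2.2] at hab
    push Not at hab
    obtain ⟨c, hc⟩ := hab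
    rcases d.reduced a a.2 b b.2 c hc.symm with h | h
    · exact Or.inl h.symm
    · exact Or.inr (by rw [h, neg_neg])
  · have : Nontrivial Y := by
      obtain ⟨a, ha⟩ := d.nonempty
      exact ⟨a, 0, ha.2⟩
    refine RootPairing.IsIrreducible.mk' P fun q hq hq0 => ?_
    -- Reflection in `a` moves `x ∈ q` by a multiple of `a`, so `a ∉ q` forces `φ a` to vanish on
    -- `q`. Roots inside and outside an invariant subspace are thus orthogonal, and connectedness
    -- applies.
    have hker (a : Y) (ha : a ∈ S \ {0}) (haq : a ∉ q) (x : Y) (hx : x ∈ q) : φ a x = 0 := by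
      by_contra h0
      have h1 : P.reflection ⟨a, ha⟩ x ∈ q := hq ⟨a, ha⟩ hx
      rw [RootPairing.reflection_apply, hP, hroot] at h1
      exact haq ((q.smul_mem_iff h0).1 ((q.sub_mem_iff_right hx).1 h1))
    rcases d.connected {a ∈ S \ {0} | a ∈ q} {a ∈ S \ {0} | a ∉ q}
      (by ext a; simp only [Set.mem_union, Set.mem_ofPred_eq]; tauto)
      (fun a ha b hb => hker b hb.1 hb.2 a ha.2) with h1 | h1
    · refine absurd ((Submodule.eq_bot_iff q).2 fun x hx => ?_) hq0
      exact d.eq_zero_of_forall fun a ha => hker a ha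
        (fun haq => (h1 ▸ (⟨ha, haq⟩ : a ∈ {a ∈ S \ {0} | a ∈ q}) : a ∈ (∅ : Set Y))) x hx
    · rw [eq_top_iff, ← d.span_eq_top, Submodule.span_le]
      intro a ha
      by_contra haq
      have h0 : a ≠ 0 := by rintro rfl; exact haq q.zero_mem
      exact (h1 ▸ (⟨⟨ha, h0⟩, haq⟩ : a ∈ {a ∈ S \ {0} | a ∉ q}) : a ∈ (∅ : Set Y))

theorem map {Y' : Type*} [AddCommGroup Y'] [Module F Y'] (e : Y ≃ₗ[F] Y') :
    IsRootData (e '' S) (fun y => (φ (e.symm y)).comp e.symm.toLinearMap) := by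
  have hdiff : e '' S \ {0} = e '' (S \ {0}) := by
    rw [Set.image_sdiff e.injective, Set.image_singleton, map_zero]
  refine ⟨⟨0, d.zero_mem, map_zero e⟩, d.finite.image e, ?_, ?_, ?_, ?_, ?_, ?_, ?_, ?_⟩
  · rw [← LinearEquiv.coe_coe, Submodule.span_image, d.span_eq_top, Submodule.map_top,
      LinearEquiv.range]
  · rw [hdiff]
    rintro _ ⟨a, ha, rfl⟩
    simpa using d.two a ha
  · rw [hdiff]
    rintro _ ⟨a, ha, rfl⟩ _ ⟨b, hb, rfl⟩ hab
    refine congrArg e (d.injOn ha hb (LinearMap.ext fun x => ?_))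
    simpa using LinearMap.congr_fun hab (e x)
  · rw [hdiff]
    rintro _ ⟨a, ha, rfl⟩ _ ⟨b, hb, rfl⟩
    exact ⟨_, d.reflection_mem a ha b hb, by simp⟩
  · rw [hdiff]
    rintro _ ⟨a, ha, rfl⟩ _ ⟨b, hb, rfl⟩
    simpa using d.exists_int a ha b hb
  · rw [hdiff]
    rintro _ ⟨a, ha, rfl⟩ _ ⟨b, hb, rfl⟩ c hc
    rw [← map_smul] at hc
    rcases d.reduced a ha b hb c (e.injective hc) with h | h
    · exact Or.inl (congrArg e h)
    · exact Or.inr (by rw [h, map_neg])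
  · rw [hdiff]
    intro S₁ S₂ h12 horth
    have hS : S \ {0} = e ⁻¹' S₁ ∪ e ⁻¹' S₂ := by
      rw [← Set.preimage_union, ← h12, Set.preimage_image_eq _ e.injective]
    rcases d.connected _ _ hS (fun a ha b hb => by simpa using horth _ ha _ hb) with h | h
    · exact Or.inl ((Set.preimage_eq_empty_iff.1 h).eq_bot_of_le (by simp [e.surjective.range_eq]))
    · exact Or.inr ((Set.preimage_eq_empty_iff.1 h).eq_bot_of_le (by simp [e.surjective.range_eq]))
  · rw [hdiff]
    exact d.nonempty.image e

end IsRootData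

end EALA

/-! ### Core, simplicity and the root system when no nonzero root is null -/

namespace EALA

variable {F E : Type*} [Field F] [LieRing E] [LieAlgebra F E]

theorem toQuotient_bijective {Y : Type*} [AddCommGroup Y] [Module F Y]
    {b : LinearMap.BilinForm F Y} {R : Set Y} (h : spanRadical b R = ⊥) :
    Function.Bijective (toQuotient b R) := by
  refine ⟨LinearMap.ker_eq_bot.1 ?_, Submodule.mkQ_surjective _⟩
  rw [toQuotient, Submodule.ker_mkQ, h]

namespace IsToralPair

variable {H : LieSubalgebra F E} {B : LinearMap.BilinForm F E} (h : IsToralPair H B)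
include h

theorem lie_coe_coe (k l : H) : ⁅(k : E), (l : E)⁆ = 0 := by
  simpa using h.coe_mem_rootSpace_zero l k

/-- An element of `H` annihilated by all roots is central. -/
theorem lie_eq_zero_of_forall_roots {k : H} (hk : ∀ α ∈ roots H, α k = 0) (x : E) :
    ⁅(k : E), x⁆ = 0 := by
  refine forall_of_rootSpace h.iSup_eq_top (N := LinearMap.ker (LieModule.toEnd F E E k))
    (fun α hα y hy => ?_) x
  rw [LinearMap.mem_ker, LieModule.toEnd_apply_apply, hy k, hk α hα, zero_smul]

theorem span_roots_eq_top (hk : ∀ k : H, (∀ α ∈ roots H, α k = 0) → k = 0) :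
    Submodule.span F (roots H) = ⊤ := by
  have := h.finiteDimensional
  have hbot : (Submodule.span F (roots H)).dualCoannihilator = ⊥ :=
    (Submodule.eq_bot_iff _).2 fun k hk' => hk k fun α hα =>
      (Submodule.mem_dualCoannihilator k).1 hk' α (Submodule.subset_span hα)
  rw [← Subspace.dualCoannihilator_dualAnnihilator_eq (W := Submodule.span F (roots H)), hbot,
    Submodule.dualAnnihilator_bot]

theorem rootSpace_le_core {α : Dual F H} (hα : α ∈ h.anisotropicRoots) {x : E}
    (hx : x ∈ rootSpace H α) : x ∈ h.core :=
  LieSubalgebra.subset_lieSpan (Set.mem_biUnion hα hx)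

theorem t_mem_core [CharZero F] {α : Dual F H} (hα : α ∈ h.anisotropicRoots) :
    (h.t α : E) ∈ h.core := by
  obtain ⟨x, hx, hx0⟩ := exists_ne_zero_of_mem_roots hα.1
  obtain ⟨y, hy, hxy⟩ := h.exists_form_eq hx hx0 1
  have h1 := h.core.lie_mem (h.rootSpace_le_core hα hx)
    (h.rootSpace_le_core (h.neg_mem_anisotropicRoots hα) hy)
  rwa [h.lie_eq_smul_t hx hy, hxy, one_smul] at h1

/-- If there are no non-zero null roots and the roots span, then the core is everything. -/
theorem core_eq_top [CharZero F] (hN : ∀ δ ∈ roots H, h.dualForm δ δ = 0 → δ = 0)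
    (hspan : Submodule.span F (roots H) = ⊤) : h.core = ⊤ := by
  have hH (ξ : Dual F H) : (h.t ξ : E) ∈ h.core := by
    have : Submodule.span F (roots H) ≤ h.core.toSubmodule.comap
        (H.toSubmodule.subtype ∘ₗ h.t.toLinearMap) := Submodule.span_le.2 fun α hα => by
      by_cases h0 : α = 0
      · simp [h0]
      · exact h.t_mem_core ⟨hα, fun h1 => h0 (hN α hα h1)⟩
    rw [hspan] at this
    exact this (Submodule.mem_top (x := ξ))
  refine eq_top_iff.2 fun x _ => ?_
  refine forall_of_rootSpace h.iSup_eq_top (N := h.core.toSubmodule) (fun α hα y hy => ?_) x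
  by_cases h0 : α = 0
  · rw [h0, h.selfCentralizing] at hy
    simpa using hH (h.t.symm ⟨y, hy⟩)
  · exact h.rootSpace_le_core ⟨hα, fun h1 => h0 (hN α hα h1)⟩ hy

end IsToralPair

namespace IsEALAForm

variable {H : LieSubalgebra F E} {B : LinearMap.BilinForm F E} (h : IsEALAForm H B) [CharZero F]
  (hN : ∀ δ ∈ roots H, h.toral.dualForm δ δ = 0 → δ = 0)
include hN

omit [CharZero F] in
theorem mem_anisotropicRoots_iff {α : Dual F H} :
    α ∈ h.toral.anisotropicRoots ↔ α ∈ roots H ∧ α ≠ 0 :=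
  ⟨fun hα => ⟨hα.1, fun h0 => hα.2 (by simp [h0])⟩, fun hα => ⟨hα.1, fun h0 => hα.2 (hN α hα.1 h0)⟩⟩

omit [CharZero F] hN in
theorem span_inSpan (R : Set (Dual F H)) : Submodule.span F (inSpan (F := F) R) = ⊤ :=
  Submodule.span_span_coe_preimage

/-- The functionals are `2(a|·)/(a|a)`, restricted to the span of the roots. -/
theorem isRootData : IsRootData (inSpan (F := F) (roots H)) (fun a =>
    (2 / h.toral.dualForm a a) • (h.toral.dualForm a).comp (Submodule.subtype _)) := by
  have hmem {a : Submodule.span F (roots H)} (ha : a ∈ inSpan (F := F) (roots H) \ {0}) :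
      (a : Dual F H) ∈ h.toral.anisotropicRoots :=
    (h.mem_anisotropicRoots_iff hN).2 ⟨ha.1, fun h0 => ha.2 (Subtype.ext h0)⟩
  have hint {a b : Submodule.span F (roots H)} (ha : a ∈ inSpan (F := F) (roots H) \ {0})
      (hb : b ∈ inSpan (F := F) (roots H)) :
      ∃ z : ℤ, 2 * h.toral.dualForm b a = z * h.toral.dualForm a a ∧
        2 / h.toral.dualForm a a * h.toral.dualForm a b = z := by
    obtain ⟨z, hz⟩ := h.exists_int (hmem ha) hb
    refine ⟨z, hz, ?_⟩
    have h0 := (hmem ha).2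
    rw [h.toral.dualForm_comm a b]
    rw [div_mul_eq_mul_div, div_eq_iff h0, hz]
  refine ⟨h.toral.zero_mem_roots, ?_, span_inSpan _, ?_, ?_, ?_, ?_, ?_, ?_, ?_⟩
  · exact (h.finite_roots hN).preimage Subtype.val_injective.injOn
  · intro a ha
    simpa using div_mul_cancel₀ _ (hmem ha).2
  · intro a ha b hb hab
    -- Evaluating equal coroots at `a` and `b` gives `(a|a) = (a|b) = (b|b)`, so `a - b` is
    -- orthogonal to both.
    have h1 := LinearMap.congr_fun hab a
    have h2 := LinearMap.congr_fun hab b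
    have ha0 := (hmem ha).2
    have hb0 := (hmem hb).2
    simp only [LinearMap.smul_apply, LinearMap.comp_apply, Submodule.subtype_apply,
      smul_eq_mul, div_mul_cancel₀ _ ha0, div_mul_cancel₀ _ hb0] at h1 h2
    have hc := h.toral.dualForm_comm a b
    rw [eq_comm, div_mul_eq_mul_div, div_eq_iff hb0] at h1
    rw [div_mul_eq_mul_div, div_eq_iff ha0] at h2
    have h1' := mul_left_cancel₀ two_ne_zero h1
    have h2' := mul_left_cancel₀ two_ne_zero h2
    refine Subtype.ext (h.eq_of_sub_orthogonal hN ha.1 (hmem hb) ?_ ?_)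
    · rw [map_sub, LinearMap.sub_apply, ← hc, h2', sub_self]
    · rw [map_sub, LinearMap.sub_apply, hc, h1', sub_self]
  · intro a ha b hb
    obtain ⟨z, hz, hz'⟩ := hint ha hb
    have h1 := h.reflection_mem_roots (hmem ha) hb hz
    rw [← Int.cast_smul_eq_zsmul F, ← hz'] at h1
    exact h1
  · intro a ha b hb
    obtain ⟨z, -, hz'⟩ := hint ha hb
    exact ⟨z, by simp [hz']⟩
  · intro a ha b hb c hc
    rcases h.eq_or_eq_neg_of_smul (hmem ha) (hmem hb) (congrArg Subtype.val hc) with h1 | h1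
    · exact Or.inl (Subtype.ext h1)
    · exact Or.inr (Subtype.ext h1)
  · intro S₁ S₂ h12 horth
    have hS : h.toral.anisotropicRoots = Subtype.val '' S₁ ∪ Subtype.val '' S₂ := by
      rw [← Set.image_union, ← h12]
      ext α
      rw [h.mem_anisotropicRoots_iff hN]
      constructor
      · intro hα
        exact ⟨⟨α, Submodule.subset_span hα.1⟩, ⟨hα.1, fun h0 => hα.2 (congrArg Subtype.val h0)⟩,
          rfl⟩
      · rintro ⟨a, ha, rfl⟩
        exact (h.mem_anisotropicRoots_iff hN).1 (hmem ha)
    rcases h.connected _ _ hS (by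
      rintro _ ⟨a, ha, rfl⟩ _ ⟨b, hb, rfl⟩
      have hb' := hmem (h12 ▸ Or.inr hb : b ∈ inSpan (F := F) (roots H) \ {0})
      have h1 := horth a ha b hb
      simp only [LinearMap.smul_apply, LinearMap.comp_apply, Submodule.subtype_apply,
        smul_eq_mul] at h1
      rw [h.toral.dualForm_comm]
      exact (mul_eq_zero.1 h1).resolve_left (div_ne_zero two_ne_zero hb'.2)) with h1 | h1
    · exact Or.inl (Set.image_eq_empty.1 h1)
    · exact Or.inr (Set.image_eq_empty.1 h1)
  · obtain ⟨α, hα⟩ := h.anisotropicRoots_nonempty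
    have h1 := (h.mem_anisotropicRoots_iff hN).1 hα
    exact ⟨⟨α, Submodule.subset_span h1.1⟩, h1.1, fun h0 => h1.2 (congrArg Subtype.val h0)⟩

/-- The form is nondegenerate on the span of the roots. -/
theorem spanRadical_eq_bot : spanRadical h.toral.dualForm (roots H) = ⊥ := by
  refine (Submodule.eq_bot_iff _).2 fun x hx => (h.isRootData hN).eq_zero_of_forall fun a _ => ?_
  have h1 : h.toral.dualForm x a = 0 := LinearMap.congr_fun (LinearMap.mem_ker.1 hx) a
  simp [h.toral.dualForm_comm a x, h1]

/-- Elements of `H` killed by all roots are central, so by tameness they lie in the core; being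
orthogonal to the core, they form a totally isotropic space. With `X` the span of the roots, `H* = X
⊕ X^⊥`; `k` is orthogonal to `t(X)` since the roots kill it, and to `t(X^⊥)` since that lies in the
isotropic space. -/
theorem eq_zero_of_forall_roots {k : H} (hk : ∀ α ∈ roots H, α k = 0) : k = 0 := by
  have := h.toral.finiteDimensional
  have hcore {k l : H} (hk : ∀ α ∈ roots H, α k = 0) (hl : ∀ α ∈ roots H, α l = 0) :
      B k l = 0 := by
    have hl' : (l : E) ∈ h.toral.core :=
      h.tame l fun x _ => h.toral.lie_eq_zero_of_forall_roots hl x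
    let C : LieSubalgebra F E :=
      { LinearMap.ker (B k) with
        lie_mem' := by
          intro a b _ _
          change B k ⁅a, b⁆ = 0
          rw [← h.toral.invariant, h.toral.lie_eq_zero_of_forall_roots hk, map_zero,
            LinearMap.zero_apply] }
    have hle : h.toral.core ≤ C := by
      refine LieSubalgebra.lieSpan_le.2 fun y hy => ?_
      simp only [Set.mem_iUnion] at hy
      obtain ⟨α, hα, hy⟩ := hy
      refine h.toral.form_eq_zero ?_ (h.toral.coe_mem_rootSpace_zero k) hy
      rw [zero_add]
      exact ((h.mem_anisotropicRoots_iff hN).1 hα).2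
    exact hle hl'
  have hrefl : h.toral.dualForm.IsRefl := fun a b hab => by rw [h.toral.dualForm_comm, hab]
  have hnd : (h.toral.dualForm.restrict (Submodule.span F (roots H))).Nondegenerate := by
    have h1 : ∀ x : Submodule.span F (roots H), (∀ y : Submodule.span F (roots H),
        h.toral.dualForm x y = 0) → x = 0 := fun x hx => by
      have : x ∈ spanRadical h.toral.dualForm (roots H) := LinearMap.mem_ker.2 (LinearMap.ext hx)
      rwa [h.spanRadical_eq_bot hN, Submodule.mem_bot] at this
    exact ⟨fun x hx => h1 x hx, fun x hx => h1 x fun y => hrefl _ _ (hx y)⟩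
  have hcompl := LinearMap.BilinForm.isCompl_orthogonal_of_restrict_nondegenerate hrefl hnd
  refine h.toral.nondegenerate_restrict.1 k fun l => ?_
  change B k l = 0
  obtain ⟨ξ, rfl⟩ := h.toral.t.surjective l
  obtain ⟨ξ₁, h1, ξ₂, h2, rfl⟩ := Submodule.mem_sup.1
    (hcompl.sup_eq_top ▸ Submodule.mem_top : ξ ∈ _ ⊔ _)
  have hle : Submodule.span F (roots H) ≤ LinearMap.ker (Dual.eval F H k) :=
    Submodule.span_le.2 fun α hα => hk α hα
  have e1 : B k (h.toral.t ξ₁) = 0 := by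
    rw [h.toral.symm, h.toral.t_spec]
    exact hle h1
  have e2 : B k (h.toral.t ξ₂) = 0 := by
    refine hcore hk fun α hα => ?_
    rw [← h.toral.dualForm_apply_left]
    exact h2 α (Submodule.subset_span hα)
  rw [map_add, Submodule.coe_add, map_add, e1, e2, add_zero]

theorem span_roots_eq_top : Submodule.span F (roots H) = ⊤ :=
  h.toral.span_roots_eq_top fun _ hk => h.eq_zero_of_forall_roots hN hk

theorem core_eq_top : h.toral.core = ⊤ := h.toral.core_eq_top hN (h.span_roots_eq_top hN)

/-- An ideal is graded. Inside `H`, its elements are killed by all roots, hence zero. Otherwise it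
contains a root vector, hence some `t_α`, hence every root space not orthogonal to α; connectedness
spreads this to all anisotropic root spaces, and these generate `E`. -/
theorem isSimple : LieAlgebra.IsSimple F E := by
  constructor
  · intro I
    by_cases hI : I.toSubmodule ≤ H.toSubmodule
    · left
      refine (LieSubmodule.eq_bot_iff _).2 fun x hx => ?_
      have : (⟨x, hI hx⟩ : H) = 0 := h.eq_zero_of_forall_roots hN fun α hα => ?_
      · exact congrArg Subtype.val this
      · by_cases h0 : α = 0
        · simp [h0]
        obtain ⟨y, hy, hy0⟩ := exists_ne_zero_of_mem_roots hα
        have h1 : ⁅x, y⁆ ∈ I := lie_mem_left F E I x y hx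
        have h2 : ⁅x, y⁆ = α ⟨x, hI hx⟩ • y := hy ⟨x, hI hx⟩
        have h3 := hI h1
        rw [h2] at h3
        by_contra hne
        have h4 : y ∈ H.toSubmodule := (Submodule.smul_mem_iff _ hne).1 h3
        obtain ⟨k, hk⟩ := exists_apply_ne_zero h0
        have h5 := hy k
        rw [h.toral.lie_coe_coe k ⟨y, h4⟩, eq_comm, smul_eq_zero] at h5
        exact h5.elim hk hy0
    · right
      obtain ⟨x, hxI, hxH⟩ := SetLike.not_le_iff_exists.1 hI
      obtain ⟨s, v, hv, rfl⟩ := exists_components h.toral.iSup_eq_top x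
      have hcomp := components_mem (N := I.toSubmodule) (fun k y hy => I.lie_mem hy) s v
        (fun α _ => hv α) hxI
      have hcoroot {α : Dual F H} (hα : α ∈ h.toral.anisotropicRoots) {x : E} (hx0 : x ≠ 0)
          (hx : x ∈ rootSpace H α) (hxI : x ∈ I) : (h.toral.t α : E) ∈ I := by
        obtain ⟨y, hy, hxy⟩ := h.toral.exists_form_eq hx hx0 1
        have h1 : ⁅x, y⁆ ∈ I := lie_mem_left F E I x y hxI
        rwa [h.toral.lie_eq_smul_t hx hy, hxy, one_smul] at h1
      have hspread {α β : Dual F H} (ht : (h.toral.t α : E) ∈ I)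
          (hβ : h.toral.dualForm β α ≠ 0) {y : E} (hy : y ∈ rootSpace H β) : y ∈ I := by
        have h1 : ⁅(h.toral.t α : E), y⁆ ∈ I := lie_mem_left F E I _ y ht
        rw [h.toral.lie_t_rootSpace hy] at h1
        exact (Submodule.smul_mem_iff I.toSubmodule hβ).1 h1
      have hex : ∃ α ∈ h.toral.anisotropicRoots, (h.toral.t α : E) ∈ I := by
        by_contra! hc
        refine hxH (Submodule.sum_mem _ fun α hα => ?_)
        by_cases hv0 : v α = 0
        · rw [hv0]; exact Submodule.zero_mem _
        by_cases h0 : α = 0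
        · rw [← h.toral.selfCentralizing, ← h0]; exact hv α
        · have hα' := (h.mem_anisotropicRoots_iff hN).2 ⟨mem_roots_of_mem (hv α) hv0, h0⟩
          exact absurd (hcoroot hα' hv0 (hv α) (hcomp α hα)) (hc α hα')
      have hall : ∀ β ∈ h.toral.anisotropicRoots, (h.toral.t β : E) ∈ I := by
        rcases h.connected {α ∈ h.toral.anisotropicRoots | (h.toral.t α : E) ∈ I}
          {α ∈ h.toral.anisotropicRoots | (h.toral.t α : E) ∉ I}
          (by ext a; simp only [Set.mem_union, Set.mem_ofPred_eq]; tauto) (by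
            intro α hα β hβ
            by_contra hne
            rw [h.toral.dualForm_comm] at hne
            obtain ⟨y, hy, hy0⟩ := exists_ne_zero_of_mem_roots hβ.1.1
            exact hβ.2 (hcoroot hβ.1 hy0 hy (hspread hα.2 hne hy))) with h1 | h1
        · obtain ⟨α, hα⟩ := hex
          exact absurd hα (Set.eq_empty_iff_forall_notMem.1 h1 α)
        · intro β hβ
          by_contra hne
          exact Set.eq_empty_iff_forall_notMem.1 h1 β ⟨hβ, hne⟩
      let C : LieSubalgebra F E :=
        { I.toSubmodule with lie_mem' := fun {a b} ha _ => lie_mem_left F E I a b ha }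
      have hle : h.toral.core ≤ C := by
        refine LieSubalgebra.lieSpan_le.2 fun y hy => ?_
        simp only [Set.mem_iUnion] at hy
        obtain ⟨α, hα, hy⟩ := hy
        exact hspread (hall α hα) hα.2 hy
      rw [h.core_eq_top hN] at hle
      exact eq_top_iff.2 fun x _ => hle (LieSubalgebra.mem_top x)
  · intro hab
    obtain ⟨α, hα⟩ := h.anisotropicRoots_nonempty
    obtain ⟨x, hx, hx0⟩ := exists_ne_zero_of_mem_roots hα.1
    obtain ⟨k, hk⟩ := exists_apply_ne_zero ((h.mem_anisotropicRoots_iff hN).1 hα).2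
    have h1 := hx k
    rw [hab.trivial, eq_comm, smul_eq_zero] at h1
    exact h1.elim hk hx0

theorem isSplitSimple : IsSplitSimple H where
  finiteDimensional := h.finiteDimensional_of_nullRoots hN
  simple := h.isSimple hN
  cartan := by
    refine ⟨?_, ?_⟩
    · have : IsLieAbelian H := ⟨fun k l => Subtype.ext (h.toral.lie_coe_coe k l)⟩
      infer_instance
    · refine le_antisymm (fun x hx => ?_) H.le_normalizer
      obtain ⟨s, v, hv, rfl⟩ := exists_components h.toral.iSup_eq_top x
      have hcomp := components_mem (N := H.normalizer.toSubmodule)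
        (fun k y hy => H.normalizer.lie_mem (H.le_normalizer k.2) hy) s v (fun α _ => hv α) hx
      refine Submodule.sum_mem H.toSubmodule fun α hα => ?_
      by_cases h0 : α = 0
      · rw [← h.toral.selfCentralizing, ← h0]; exact hv α
      · obtain ⟨k, hk⟩ := exists_apply_ne_zero h0
        have h1 := (H.mem_normalizer_iff' _).1 (hcomp α hα) k k.2
        rw [hv α k] at h1
        exact (Submodule.smul_mem_iff H.toSubmodule hk).1 h1
  split := by
    refine ⟨fun k => eq_top_iff.2 ?_⟩
    rw [← h.toral.iSup_eq_top]
    refine iSup_le fun α => le_iSup_of_le (α k) fun x hx => ?_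
    exact (Module.End.mem_maxGenEigenspace _ _ _).2 ⟨1, by
      simp [sub_eq_zero]; exact hx k⟩

theorem bijective_toQuotient :
    Function.Bijective (toQuotient h.toral.dualForm (roots H)) :=
  toQuotient_bijective (h.spanRadical_eq_bot hN)

theorem isIrreducibleReducedRootSystem_quotientRoots :
    IsIrreducibleReducedRootSystem (F := F) (quotientRoots h.toral.dualForm (roots H)) :=
  ((h.isRootData hN).map (LinearEquiv.ofBijective _
    (h.bijective_toQuotient hN))).isIrreducibleReducedRootSystem

end IsEALAForm

end EALA

/-! ### Split simple Lie algebras are EALAs of nullity 0 -/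

namespace EALA

variable {F E : Type*} [Field F] [LieRing E] [LieAlgebra F E]

namespace IsToralPair

variable {H : LieSubalgebra F E} {B : LinearMap.BilinForm F E} (h : IsToralPair H B)
  (hN : ∀ δ ∈ roots H, h.dualForm δ δ = 0 → δ = 0)
include hN

theorem subsingleton_nullLattice : Subsingleton h.nullLattice := by
  have : h.nullLattice = ⊥ := AddSubgroup.closure_eq_bot_iff.2 fun δ hδ => hN δ hδ.1 hδ.2
  rw [this]
  infer_instance

theorem nullity_eq_zero : h.nullity = 0 :=
  have := h.subsingleton_nullLattice hN
  finrank_zero_of_subsingleton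

end IsToralPair

namespace IsSplitSimple

variable {H : LieSubalgebra F E} [CharZero F] (h : IsSplitSimple H)
include h

theorem isKilling : LieAlgebra.IsKilling F E := by
  have := h.finiteDimensional
  have := h.simple
  infer_instance

/-- For a nondegenerate Killing form and a splitting Cartan subalgebra, `H` acts semisimply, so
generalized weight vectors are genuine ones. -/
theorem rootSpace_eq [LieRing.IsNilpotent H] (α : Dual F H) :
    rootSpace H α = (LieAlgebra.rootSpace H α).toSubmodule := by
  have := h.finiteDimensional
  have := h.isKilling
  have := h.cartan
  have := h.split
  refine le_antisymm (fun x hx => ?_)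
    fun x hx k => LieAlgebra.IsKilling.lie_eq_smul_of_mem_rootSpace hx k
  refine (LieModule.mem_genWeightSpace _ _ _).2 fun k => ⟨1, ?_⟩
  simpa [sub_eq_zero] using hx k

theorem isToralPair : IsToralPair H (killingForm F E) := by
  have := h.finiteDimensional
  have := h.isKilling
  have := h.cartan
  have := h.split
  refine ⟨fun x y => LieModule.traceForm_comm F E E x y,
    fun x y z => LieModule.traceForm_apply_lie_apply F E E x y z,
    (LieAlgebra.IsKilling.killingForm_nondegenerate F E).1, ?_, inferInstance, ?_, ?_, ?_⟩
  · have : Nontrivial E := by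
      by_contra hc
      rw [not_nontrivial_iff_subsingleton] at hc
      exact h.simple.non_abelian ⟨fun _ _ => Subsingleton.elim _ _⟩
    exact H.ne_bot_of_isCartanSubalgebra
  · have := (LieSubmodule.iSupIndep_toSubmodule.2
      (LieModule.iSupIndep_genWeightSpace F H E)).comp (DFunLike.coe_injective (F := Dual F H))
    convert! this using 1
    exact funext h.rootSpace_eq
  · rw [eq_top_iff]
    have h1 := congrArg LieSubmodule.toSubmodule (LieModule.iSup_genWeightSpace_eq_top' F H E)
    rw [LieSubmodule.iSup_toSubmodule, LieSubmodule.top_toSubmodule] at h1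
    rw [← h1]
    exact iSup_le fun χ => le_iSup_of_le χ.toLinear (h.rootSpace_eq χ.toLinear).ge
  · rw [h.rootSpace_eq]
    exact congrArg LieSubmodule.toSubmodule (LieAlgebra.rootSpace_zero_eq F E H)

theorem eq_zero_of_forall_roots {k : H} (hk : ∀ α ∈ roots H, α k = 0) : k = 0 := by
  have := h.finiteDimensional
  have := h.simple
  have hc : (k : E) ∈ LieAlgebra.center F E := by
    refine (LieModule.mem_maxTrivSubmodule F E E _).2 fun x => ?_
    rw [← lie_skew, h.isToralPair.lie_eq_zero_of_forall_roots hk, neg_zero]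
  rw [LieAlgebra.center_eq_bot, LieSubmodule.mem_bot] at hc
  exact Subtype.ext hc

theorem null_eq_zero : ∀ δ ∈ roots H, h.isToralPair.dualForm δ δ = 0 → δ = 0 := by
  intro δ hδ hnull
  have := h.finiteDimensional
  by_contra hδ0
  refine hδ0 (h.isToralPair.t.map_eq_zero_iff.1 (h.eq_zero_of_forall_roots fun α hα => ?_))
  rw [← h.isToralPair.dualForm_apply_left]
  exact h.isToralPair.dualForm_eq_zero_of_null
    (finite_roots_of_finiteDimensional h.isToralPair.independent) hδ hδ0 hnull hα

/-- The roots of a split simple Lie algebra do not decompose into two orthogonal subsets. -/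
theorem connected (R₁ R₂ : Set (Dual F H)) (h12 : h.isToralPair.anisotropicRoots = R₁ ∪ R₂)
    (horth : ∀ α ∈ R₁, ∀ β ∈ R₂, h.isToralPair.dualForm α β = 0) : R₁ = ∅ ∨ R₂ = ∅ := by
  have := h.finiteDimensional
  have := h.simple
  have := h.isKilling
  have := h.cartan
  have := h.split
  have ht (α : Dual F H) :
      (LieAlgebra.IsKilling.cartanEquivDual H).symm α = h.isToralPair.t α := by
    rw [LinearEquiv.symm_apply_eq]
    ext k
    exact (h.isToralPair.t_spec α k).symm
  rw [or_iff_not_imp_left, ← ne_eq, ← Set.nonempty_iff_ne_empty]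
  rintro ⟨α, hα⟩
  rw [Set.eq_empty_iff_forall_notMem]
  intro β hβ
  have hker {β : Dual F H} (hβ : β ∈ R₂) :
      Submodule.span F R₁ ≤ LinearMap.ker (Dual.eval F H (h.isToralPair.t β)) :=
    Submodule.span_le.2 fun α hα => by
      have := horth α hα β hβ
      rwa [h.isToralPair.dualForm_apply_left] at this
  have hα0 : α ≠ 0 := by
    have hα' : α ∈ h.isToralPair.anisotropicRoots := h12 ▸ Or.inl hα
    rintro rfl
    exact hα'.2 (by simp)
  -- The span of `R₁` is stable under all reflections: a root in `R₁` adds elements of the span, and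
  -- the coroot of a root in `R₂` kills it. By irreducibility it is everything, so `β ∈ R₂` is
  -- orthogonal to itself.
  have htop : Submodule.span F R₁ = ⊤ := by
    refine RootPairing.IsIrreducible.eq_top_of_invtSubmodule_reflection
      (P := LieAlgebra.IsKilling.rootSystem H) _ (fun i x hx => ?_)
      fun h0 => hα0 ((Submodule.mem_bot F).1 (h0 ▸ Submodule.subset_span hα))
    change (LieAlgebra.IsKilling.rootSystem H).reflection i x ∈ Submodule.span F R₁
    rw [RootPairing.reflection_apply]
    refine Submodule.sub_mem _ hx ?_
    have hi0 : i.1.toLinear ≠ 0 := fun h0 =>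
      H.isNonZero_coe_root i (funext fun k => LinearMap.congr_fun h0 k)
    have hi : i.1.toLinear ∈ roots H := by
      intro h0
      rw [h.rootSpace_eq] at h0
      exact i.1.genWeightSpace_ne_bot' ((LieSubmodule.toSubmodule_eq_bot _).1 h0)
    have hi' : i.1.toLinear ∈ R₁ ∪ R₂ :=
      h12 ▸ ⟨hi, fun h1 => hi0 (h.null_eq_zero _ hi h1)⟩
    rcases hi' with hi' | hi'
    · exact Submodule.smul_mem _ _ (Submodule.subset_span hi')
    · have h1 : x (h.isToralPair.t i.1.toLinear) = 0 := hker hi' hx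
      have h2 : (LieAlgebra.IsKilling.rootSystem H).coroot' i x = 0 := by
        change x (LieAlgebra.IsKilling.coroot i.1) = 0
        rw [LieAlgebra.IsKilling.coroot, ht, map_nsmul, map_smul, h1, smul_zero, smul_zero]
      rw [h2, zero_smul]
      exact Submodule.zero_mem _
  have hβ' : β ∈ h.isToralPair.anisotropicRoots := h12 ▸ Or.inr hβ
  have h1 : β (h.isToralPair.t β) = 0 := hker hβ (htop ▸ Submodule.mem_top)
  rw [← h.isToralPair.dualForm_apply_left] at h1
  exact hβ'.2 h1

theorem isEALAForm : IsEALAForm H (killingForm F E) := by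
  have := h.finiteDimensional
  refine ⟨h.isToralPair, fun α hα x hx y => ?_, h.connected, fun e _ => ?_, ?_, ?_⟩
  · refine pow_toEnd_eq_zero_of_finite
      (finite_roots_of_finiteDimensional h.isToralPair.independent) h.isToralPair.iSup_eq_top
      (fun h0 => hα.2 ?_) hx y
    rw [h0, map_zero]
  · rw [h.isToralPair.core_eq_top h.null_eq_zero
      (h.isToralPair.span_roots_eq_top fun _ hk => h.eq_zero_of_forall_roots hk)]
    exact LieSubalgebra.mem_top e
  · have := h.isToralPair.subsingleton_nullLattice h.null_eq_zero
    infer_instance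
  · have := h.isToralPair.subsingleton_nullLattice h.null_eq_zero
    infer_instance

end IsSplitSimple

/-- `finrank` is also 0 in infinite rank, so (EA6) is needed to conclude `Λ = 0`. -/
theorem null_of_nullity_eq_zero [CharZero F] {H : LieSubalgebra F E} {B : LinearMap.BilinForm F E}
    (h : IsEALAForm H B) (h0 : h.toral.nullity = 0) :
    ∀ δ ∈ roots H, h.toral.dualForm δ δ = 0 → δ = 0 := by
  intro δ hδ hnull
  have := h.free
  have := h.finite
  have := (Module.finrank_eq_zero_iff_of_free ℤ h.toral.nullLattice).1 h0
  have hmem : δ ∈ h.toral.nullLattice := AddSubgroup.subset_closure ⟨hδ, hnull⟩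
  exact congrArg Subtype.val (Subsingleton.elim (⟨δ, hmem⟩ : h.toral.nullLattice) 0)

end EALA

theorem propositionn {F E : Type*} [Field F] [CharZero F] [LieRing E] [LieAlgebra F E]
    (H : LieSubalgebra F E) :
    List.TFAE [
      EALA.IsEALAOfNullity H 0,
      EALA.IsEALA H ∧ FiniteDimensional F E,
      EALA.IsSplitSimple H] ∧
    (EALA.IsEALAOfNullity H 0 →
      ∀ (B : LinearMap.BilinForm F E) (h : EALA.IsEALAForm H B),
        h.toral.nullity = 0 ∧
        h.toral.core = ⊤ ∧
        Function.Bijective (EALA.toQuotient h.toral.dualForm (EALA.roots H)) ∧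
        EALA.IsIrreducibleReducedRootSystem (F := F)
          (EALA.quotientRoots h.toral.dualForm (EALA.roots H)) ∧
        EALA.IsIrreducibleReducedRootSystem (F := F)
          (EALA.inSpan (F := F) (EALA.roots H))) := by
  have h12 : EALA.IsEALAOfNullity H 0 → EALA.IsEALA H ∧ FiniteDimensional F E := by
    rintro ⟨B, h, h0⟩
    exact ⟨⟨B, h⟩, h.finiteDimensional_of_nullRoots (EALA.null_of_nullity_eq_zero h h0)⟩
  have hnull (hfd : FiniteDimensional F E) {B : LinearMap.BilinForm F E}
      (h : EALA.IsEALAForm H B) : ∀ δ ∈ EALA.roots H, h.toral.dualForm δ δ = 0 → δ = 0 :=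
    h.null_eq_zero_of_finite (EALA.finite_roots_of_finiteDimensional h.toral.independent)
  refine ⟨?_, fun h0 B h => ?_⟩
  · tfae_have 1 → 2 := h12
    tfae_have 2 → 3 := fun ⟨⟨B, h⟩, hfd⟩ => h.isSplitSimple (hnull hfd h)
    tfae_have 3 → 1 := fun h => ⟨killingForm F E, h.isEALAForm,
      h.isToralPair.nullity_eq_zero h.null_eq_zero⟩
    tfae_finish
  -- Finite-dimensionality does not depend on the form, so it excludes nonzero null roots for every
  -- admissible form.
  · have hN := hnull (h12 h0).2 h
    exact ⟨h.toral.nullity_eq_zero hN, h.core_eq_top hN, h.bijective_toQuotient hN,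
      h.isIrreducibleReducedRootSystem_quotientRoots hN,
      (h.isRootData hN).isIrreducibleReducedRootSystem⟩
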